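/- Consider the Minkowski plane $\mathbb R^{1,1}=\mathbb R^2$ with metric $g=dx^2-dy^2$ and volume form $dx\wedge dy$. Let $(\tau,n)$ be a basis of one of the following types: * space-like: $g(\tau,\tau)=1$, $g(n,n)=-1$, $g(\tau,n)=0$, with $(\tau,n)$ positively oriented (e.g. $\tau=\partial_x$, $n=\partial_y$); * time-like: $g(\tau,\tau)=-1$, $g(n,n)=1$, $g(\tau,n)=0$, with $(n,\tau)$ positively oriented (e.g. $\tau=\partial_y$, $n=\partial_x$); * light-like: $g(\tau,\tau)=g(n,n)=0$ (e.g. $\tau=\tfrac12(\partial_y+\partial_x)$, $n=\tfrac12(\partial_y-\partial_x)$). Let $s_0<s_1$ and let $D=\{a\tau+sn : a\in\mathbb R,\ s_0\le s\le s_1\}$ be the corresponding strip; its two boundary lines are identified with $\Sigma=\mathbb R$ by the parameter $a$. Fix $\eta>0$. A field on $D$ is a function $\varphi\in C^\infty(D)$ (smooth up to the boundary) whose $k$-th derivatives are $O((x^2+y^2)^{-(\eta+k)/2})$ at infinity for $k=0,1,2,\dots$. For $m>0$ let $S_m$ be the space of $f\in C^\infty(\mathbb R)$ with $f^{(k)}(a)=O(|a|^{-(m+k)})$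 at infinity for all $k\ge 0$, with its Fréchet topology given by the seminorms $\sup_a(1+a^2)^{(m+k)/2}|f^{(k)}(a)|$. The pre-phase space of $\Sigma$ is $\tilde\Phi=S_\eta\times S_{\eta+1}\ni(\phi,\phi_n)$, with the presymplectic form $\tilde\omega=\delta\tilde\alpha$, $\tilde\alpha=\int_\Sigma\mu\,(\Gamma\phi_n+u(\phi))\,\delta\phi$, where $\Sigma$ is oriented by $\tau$ and $\Gamma=g^{-1}(n^*,n^*)$, $u=g^{-1}(n^*,\cdot)-\Gamma n$, $\mu=\iota_n(dx\wedge dy)$, $n^*$ being the covector with $n^*(n)=1$, $n^*(\tau)=0$. The phase space is $\Phi=\tilde\Phi/\ker\tilde\omega$ with the induced symplectic form $\omega$. The phase space of $\partial D$ is $\bar\Phi\times\Phi$ with the form $(-\omega)\oplus\omega$, the factors belonging to $s=s_0$ and $s=s_1$. The evolution relation $L_D\subset\bar\Phi\times\Phi$ is the set of pairs of classes of the boundary values $(\varphi,\partial_n\varphi)|_{s=s_0}$, $(\varphi,\partial_n\varphi)|_{s=s_1}$ of all fields $\varphi$ on $D$ with $\partial_x^2\varphi-\partial_y^2\varphi=0$.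 A subset $L$ is called Lagrangian if it coincides with its orthogonal complement with respect to the form. Then: 1. If $(\tau,n)$ is space-like or time-like, then $\ker\tilde\omega=0$, so $\Phi=\tilde\Phi$; the relation $L_D$ is Lagrangian; and the Hamiltonian $H(\phi,\pi)=\frac12\int_{\mathbb R}(\pi^2+(\partial_a\phi)^2)\,da$, $\pi=\phi_n$, has a Hamiltonian vector field $X$ on $(\tilde\Phi,\tilde\omega)$ (that is, $\iota_X\tilde\omega=-\delta H$) which integrates to a flow $(U_t)_{t\in\mathbb R}$ on $\tilde\Phi$, differentiable in $t$ in the Fréchet topology, such that $L_D$ is the graph of $U_{s_1-s_0}$. 2. If $(\tau,n)$ is light-like, then $\ker\tilde\omega=\{\phi=0\}$, so that $\Phi$ is the space of the boundary values $\phi$ alone; and $L_D$ is the diagonal of $\bar\Phi\times\Phi$, which is Lagrangian. -/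

import Mathlib

open scoped ContDiff Topology

noncomputable section

namespace MinkowskiStrip

/-! ### The Minkowski plane: linear algebra

Points and vectors of the plane are pairs `(x, y)`; the metric is `dx² - dy²`. -/

/-- The Minkowski metric `dx² - dy²`. -/
def mink (v w : ℝ × ℝ) : ℝ := v.1 * w.1 - v.2 * w.2

/-- The metric volume element `dx ∧ dy`. -/
def area (v w : ℝ × ℝ) : ℝ := v.1 * w.2 - v.2 * w.1

/-- The covector `n*` with `n*(n) = 1` and `n*(τ) = 0`. -/
def conormal (τ n v : ℝ × ℝ) : ℝ := area τ v / area τ n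

/-- The vector `g⁻¹(n*, ·)`, i.e. the vector `N` with `mink N v = n*(v)` for all `v`. -/
def raisedConormal (τ n : ℝ × ℝ) : ℝ × ℝ := (conormal τ n (1, 0), -conormal τ n (0, 1))

/-- The boundary function `Γ = g⁻¹(n*, n*)`. -/
def bdryGamma (τ n : ℝ × ℝ) : ℝ := conormal τ n (raisedConormal τ n)

/-- The boundary vector field `u = g⁻¹(n*, ·) - Γ n`, which is tangent to the boundary line:
this is its coefficient with respect to `τ`, so that `u(f) = bdryDrift τ n * f'`
for functions of the parameter `a` of the line `a ↦ a τ + s n`. -/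
def bdryDrift (τ n : ℝ × ℝ) : ℝ :=
  conormal n τ (raisedConormal τ n - bdryGamma τ n • n)

/-- The boundary volume form `μ = ι_n (dx ∧ dy)` is `bdryDensity τ n * da`. -/
def bdryDensity (τ n : ℝ × ℝ) : ℝ := area n τ

/-- `τ` is a unit space-like vector and `n` a unit vector orthogonal to it, with `(τ, n)`
positively oriented, as for `(∂_x, ∂_y)`. -/
structure IsSpacelikeFrame (τ n : ℝ × ℝ) : Prop where
  tangent : mink τ τ = 1
  normal : mink n n = -1
  orthogonal : mink τ n = 0
  oriented : 0 < area τ n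

/-- `τ` is a unit time-like vector and `n` a unit vector orthogonal to it, with `(n, τ)`
positively oriented, as for `τ = ∂_y`, `n = ∂_x`. -/
structure IsTimelikeFrame (τ n : ℝ × ℝ) : Prop where
  tangent : mink τ τ = -1
  normal : mink n n = 1
  orthogonal : mink τ n = 0
  oriented : 0 < area n τ

/-- `τ` and `n` are linearly independent light-like vectors, as for
`τ = (∂_y + ∂_x) / 2`, `n = (∂_y - ∂_x) / 2`. -/
structure IsLightlikeFrame (τ n : ℝ × ℝ) : Prop where
  tangent : mink τ τ = 0
  normal : mink n n = 0
  independent : area τ n ≠ 0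

/-! ### Fields on a strip -/

/-- The strip `{a τ + s n : a ∈ ℝ, s₀ ≤ s ≤ s₁}`. -/
def strip (τ n : ℝ × ℝ) (s₀ s₁ : ℝ) : Set (ℝ × ℝ) :=
  {p | ∃ a s : ℝ, s ∈ Set.Icc s₀ s₁ ∧ p = a • τ + s • n}

/-- Fields on a closed domain `D`: functions smooth up to the boundary whose `k`-th derivatives
are `O((x² + y²)^(-(η + k)/2))` at infinity. (As `D` is closed and the derivatives are continuous
on `D`, the `O` at infinity is the same as the bound on all of `D` with `1 + x² + y²`.) -/
structure IsField (η : ℝ) (D : Set (ℝ × ℝ)) (φ : ℝ × ℝ → ℝ) : Prop where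
  smooth : ContDiffOn ℝ ∞ φ D
  decay : ∀ k : ℕ, ∃ C : ℝ, ∀ p ∈ D,
    ‖iteratedFDerivWithin ℝ k φ D p‖ ≤ C * (1 + p.1 ^ 2 + p.2 ^ 2) ^ (-(η + k) / 2)

/-- The Euler-Lagrange equation `∂_x² φ - ∂_y² φ = 0` on `D`. -/
def SolvesWaveEquation (D : Set (ℝ × ℝ)) (φ : ℝ × ℝ → ℝ) : Prop :=
  ∀ p ∈ D, iteratedFDerivWithin ℝ 2 φ D p (fun _ => ((1, 0) : ℝ × ℝ))
    - iteratedFDerivWithin ℝ 2 φ D p (fun _ => ((0, 1) : ℝ × ℝ)) = 0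

/-! ### The pre-phase space of a boundary line -/

/-- Smooth functions on the line with `f⁽ᵏ⁾ = O(|a|^(-(m + k)))` at infinity for all `k`. -/
def decaySpace (m : ℝ) : Submodule ℝ (ℝ → ℝ) where
  carrier := {f | ContDiff ℝ ∞ f ∧ ∀ k : ℕ, ∃ C : ℝ, ∀ a : ℝ,
    |iteratedDeriv k f a| ≤ C * (1 + a ^ 2) ^ (-(m + k) / 2)}
  zero_mem' := by
    refine ⟨contDiff_const, fun k => ⟨0, fun a => ?_⟩⟩
    simp
  add_mem' := by
    rintro f g ⟨hf, hf'⟩ ⟨hg, hg'⟩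
    refine ⟨hf.add hg, fun k => ?_⟩
    obtain ⟨C, hC⟩ := hf' k
    obtain ⟨C', hC'⟩ := hg' k
    refine ⟨C + C', fun a => ?_⟩
    rw [iteratedDeriv_add (hf.of_le (by exact_mod_cast le_top)).contDiffAt
      (hg.of_le (by exact_mod_cast le_top)).contDiffAt, add_mul]
    exact (abs_add_le _ _).trans (add_le_add (hC a) (hC' a))
  smul_mem' := by
    rintro c f ⟨hf, hf'⟩
    refine ⟨contDiff_const.smul hf, fun k => ?_⟩
    obtain ⟨C, hC⟩ := hf' k
    refine ⟨|c| * C, fun a => ?_⟩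
    have h : iteratedDeriv k (c • f) a = c * iteratedDeriv k f a := by
      rw [iteratedDeriv_const_smul (hf.of_le (by exact_mod_cast le_top)).contDiffAt, smul_eq_mul]
    rw [h, abs_mul, mul_assoc]
    exact mul_le_mul_of_nonneg_left (hC a) (abs_nonneg c)

/-- The pre-phase space of a line: pairs `(φ, φ_n)` (boundary value and transversal derivative)
with the asymptotics that the fields induce; `φ_n` is a first derivative of a field. -/
abbrev PrePhase (η : ℝ) : Type := decaySpace η × decaySpace (η + 1)

theorem integrable_mul_of_decay {r s : ℝ} (hrs : 1 < r + s) {f g : ℝ → ℝ}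
    (hf : Continuous f) (hg : Continuous g)
    (hf' : ∃ C : ℝ, ∀ a : ℝ, |f a| ≤ C * (1 + a ^ 2) ^ (-r / 2))
    (hg' : ∃ C : ℝ, ∀ a : ℝ, |g a| ≤ C * (1 + a ^ 2) ^ (-s / 2)) :
    MeasureTheory.Integrable (fun a => f a * g a) := by
  obtain ⟨C, hC⟩ := hf'
  obtain ⟨C', hC'⟩ := hg'
  have h1 : MeasureTheory.Integrable
      (fun a : ℝ => C * C' * (1 + a ^ 2) ^ (-(r + s) / 2)) := by
    have := integrable_rpow_neg_one_add_norm_sq (E := ℝ) (μ := MeasureTheory.volume)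
      (r := r + s) (by simpa using hrs)
    simpa using this.const_mul (C * C')
  refine h1.mono' (hf.mul hg).aestronglyMeasurable (Filter.Eventually.of_forall fun a => ?_)
  have hpos : (0 : ℝ) < 1 + a ^ 2 := by positivity
  rw [Real.norm_eq_abs, abs_mul]
  calc |f a| * |g a| ≤ (C * (1 + a ^ 2) ^ (-r / 2)) * (C' * (1 + a ^ 2) ^ (-s / 2)) :=
        mul_le_mul (hC a) (hC' a) (abs_nonneg _) ((abs_nonneg _).trans (hC a))
    _ = C * C' * (1 + a ^ 2) ^ (-(r + s) / 2) := by
        rw [show -(r + s) / 2 = -r / 2 + -s / 2 by ring, Real.rpow_add hpos]; ring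

theorem differentiable_of_mem {m : ℝ} (f : decaySpace m) : Differentiable ℝ (f : ℝ → ℝ) :=
  f.2.1.differentiable (by simp)

theorem integrable_deriv_mul {η : ℝ} (hη : 0 < η) (f g : decaySpace η) :
    MeasureTheory.Integrable (fun a => deriv (f : ℝ → ℝ) a * (g : ℝ → ℝ) a) := by
  refine integrable_mul_of_decay (r := η + 1) (s := η) (by linarith)
    (f.2.1.continuous_deriv (by simp)) g.2.1.continuous ?_ ?_
  · simpa [iteratedDeriv_one] using f.2.2 1
  · simpa using g.2.2 0

theorem integrable_mul {η : ℝ} (hη : 0 < η) (f : decaySpace (η + 1)) (g : decaySpace η) :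
    MeasureTheory.Integrable (fun a => (f : ℝ → ℝ) a * (g : ℝ → ℝ) a) := by
  refine integrable_mul_of_decay (r := η + 1) (s := η) (by linarith)
    f.2.1.continuous g.2.1.continuous ?_ ?_
  · simpa using f.2.2 0
  · simpa using g.2.2 0

theorem integrable_alpha {η : ℝ} (hη : 0 < η) (c d : ℝ) (p q : PrePhase η) :
    MeasureTheory.Integrable (fun a : ℝ =>
      (c * (p.2 : ℝ → ℝ) a + d * deriv (p.1 : ℝ → ℝ) a) * (q.1 : ℝ → ℝ) a) := by
  refine (((integrable_mul hη p.2 q.1).const_mul c).add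
    ((integrable_deriv_mul hη p.1 q.1).const_mul d)).congr
    (Filter.Eventually.of_forall fun a => ?_)
  simp only [Pi.add_apply]
  ring

/-- The 1-form `α̃ = ∫ μ (Γ φ_n + u(φ)) δφ` on the pre-phase space: its value at the point `p` on
the tangent vector `q`. The line is oriented by `τ`. -/
def alphaForm (η : ℝ) (hη : 0 < η) (τ n : ℝ × ℝ) : PrePhase η →ₗ[ℝ] PrePhase η →ₗ[ℝ] ℝ :=
  LinearMap.mk₂ ℝ
    (fun p q => bdryDensity τ n * ∫ a : ℝ,
      (bdryGamma τ n * (p.2 : ℝ → ℝ) a + bdryDrift τ n * deriv (p.1 : ℝ → ℝ) a)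
        * (q.1 : ℝ → ℝ) a)
    (by
      intro p p' q
      rw [← mul_add, ← MeasureTheory.integral_add (integrable_alpha hη _ _ p q)
        (integrable_alpha hη _ _ p' q)]
      congr 2
      funext a
      have h : deriv (((p + p').1 : decaySpace η) : ℝ → ℝ) a
          = deriv (p.1 : ℝ → ℝ) a + deriv (p'.1 : ℝ → ℝ) a :=
        deriv_add (differentiable_of_mem p.1 a) (differentiable_of_mem p'.1 a)
      rw [h]
      simp only [Prod.snd_add, Submodule.coe_add, Pi.add_apply]
      ring)
    (by
      intro c p q
      rw [smul_eq_mul, mul_left_comm, ← MeasureTheory.integral_const_mul c]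
      congr 2
      funext a
      have h : deriv (((c • p).1 : decaySpace η) : ℝ → ℝ) a = c * deriv (p.1 : ℝ → ℝ) a :=
        deriv_const_mul c (differentiable_of_mem p.1 a)
      rw [h]
      simp only [Prod.smul_snd, Submodule.coe_smul, Pi.smul_apply, smul_eq_mul]
      ring)
    (by
      intro p q q'
      rw [← mul_add, ← MeasureTheory.integral_add (integrable_alpha hη _ _ p q)
        (integrable_alpha hη _ _ p q')]
      congr 2
      funext a
      simp only [Prod.fst_add, Submodule.coe_add, Pi.add_apply]
      ring)
    (by
      intro c p q
      rw [smul_eq_mul, mul_left_comm, ← MeasureTheory.integral_const_mul c]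
      congr 2
      funext a
      simp only [Prod.smul_fst, Submodule.coe_smul, Pi.smul_apply, smul_eq_mul]
      ring)

/-- The presymplectic form `ω̃ = δα̃` on the pre-phase space. -/
def preForm (η : ℝ) (hη : 0 < η) (τ n : ℝ × ℝ) : PrePhase η →ₗ[ℝ] PrePhase η →ₗ[ℝ] ℝ :=
  alphaForm η hη τ n - (alphaForm η hη τ n).flip

/-! ### The phase space -/

/-- The phase space of a line: the pre-phase space modulo the kernel of `ω̃`. -/
abbrev Phase (η : ℝ) (hη : 0 < η) (τ n : ℝ × ℝ) : Type :=
  PrePhase η ⧸ LinearMap.ker (preForm η hη τ n)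

/-- The projection from the pre-phase space to the phase space. -/
def toPhase (η : ℝ) (hη : 0 < η) (τ n : ℝ × ℝ) : PrePhase η →ₗ[ℝ] Phase η hη τ n :=
  (LinearMap.ker (preForm η hη τ n)).mkQ

theorem ker_le_ker_flip (η : ℝ) (hη : 0 < η) (τ n : ℝ × ℝ) :
    LinearMap.ker (preForm η hη τ n) ≤ LinearMap.ker
      ((LinearMap.ker (preForm η hη τ n)).liftQ (preForm η hη τ n) le_rfl).flip := by
  intro p hp
  rw [LinearMap.mem_ker] at hp ⊢
  refine LinearMap.ext fun x => ?_
  obtain ⟨q, rfl⟩ := Submodule.mkQ_surjective _ x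
  have h : preForm η hη τ n p q = 0 := by rw [hp]; rfl
  change preForm η hη τ n q p = 0
  simp only [preForm, LinearMap.sub_apply, LinearMap.flip_apply] at h ⊢
  linarith

/-- The symplectic form `ω` on the phase space, to which `ω̃` descends. -/
def phaseForm (η : ℝ) (hη : 0 < η) (τ n : ℝ × ℝ) :
    Phase η hη τ n →ₗ[ℝ] Phase η hη τ n →ₗ[ℝ] ℝ :=
  ((LinearMap.ker (preForm η hη τ n)).liftQ
    ((LinearMap.ker (preForm η hη τ n)).liftQ (preForm η hη τ n) le_rfl).flip
    (ker_le_ker_flip η hη τ n)).flip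

theorem phaseForm_toPhase (η : ℝ) (hη : 0 < η) (τ n : ℝ × ℝ) (p q : PrePhase η) :
    phaseForm η hη τ n (toPhase η hη τ n p) (toPhase η hη τ n q) = preForm η hη τ n p q := rfl

/-- The phase space of the boundary of the strip is `Φ̄ × Φ`; its symplectic form is `-ω` on the
first factor (the component `s = s₀`) plus `ω` on the second one (the component `s = s₁`). -/
def stripForm (η : ℝ) (hη : 0 < η) (τ n : ℝ × ℝ)
    (z w : Phase η hη τ n × Phase η hη τ n) : ℝ :=
  phaseForm η hη τ n z.2 w.2 - phaseForm η hη τ n z.1 w.1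

/-- A subset is Lagrangian if it equals its own orthogonal with respect to the form `Ω`
(that is, it is an isotropic and coisotropic subspace). -/
def IsLagrangian {V : Type*} (Ω : V → V → ℝ) (L : Set V) : Prop :=
  L = {z | ∀ w ∈ L, Ω z w = 0}

/-! ### The evolution relation -/

/-- `p` is the boundary value `(φ, ∂_n φ)` of the field `φ` on the line `a ↦ a τ + s n`. -/
def IsBoundaryValue {η : ℝ} (D : Set (ℝ × ℝ)) (τ n : ℝ × ℝ) (s : ℝ) (φ : ℝ × ℝ → ℝ)
    (p : PrePhase η) : Prop :=
  ∀ a : ℝ, (p.1 : ℝ → ℝ) a = φ (a • τ + s • n) ∧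
    (p.2 : ℝ → ℝ) a = fderivWithin ℝ φ D (a • τ + s • n) n

/-- The evolution relation `L_D ⊆ Φ̄ × Φ`: the boundary values, projected to the phase space,
of the fields on the strip that solve the Euler-Lagrange equation. -/
def evolutionRelation (η : ℝ) (hη : 0 < η) (τ n : ℝ × ℝ) (s₀ s₁ : ℝ) :
    Set (Phase η hη τ n × Phase η hη τ n) :=
  {z | ∃ φ : ℝ × ℝ → ℝ, IsField η (strip τ n s₀ s₁) φ ∧
    SolvesWaveEquation (strip τ n s₀ s₁) φ ∧
    ∃ p₀ p₁ : PrePhase η, IsBoundaryValue (strip τ n s₀ s₁) τ n s₀ φ p₀ ∧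
      IsBoundaryValue (strip τ n s₀ s₁) τ n s₁ φ p₁ ∧
      z = (toPhase η hη τ n p₀, toPhase η hη τ n p₁)}

/-! ### Hamiltonian flows -/

/-- The Hamiltonian `H = ½ ∫ (π² + (∂φ)²)`, where `π = φ_n` and `∂` is the derivative
along the line. -/
def hamiltonian {η : ℝ} (p : PrePhase η) : ℝ :=
  1 / 2 * ∫ a : ℝ, (((p.2 : ℝ → ℝ) a) ^ 2 + (deriv (p.1 : ℝ → ℝ) a) ^ 2)

/-- `X` is the Hamiltonian vector field of `H`: `ι_X Ω = -δH`, that is, `δH(w) = Ω(w, X)`. (With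
`Ω = ∫ δπ ∧ δφ` these are Hamilton's equations `φ' = δH/δπ`, `π' = -δH/δφ`.) -/
def IsHamiltonianVectorField {V : Type*} [AddCommGroup V] [Module ℝ V]
    (Ω : V →ₗ[ℝ] V →ₗ[ℝ] ℝ) (H : V → ℝ) (X : V → V) : Prop :=
  ∀ p w : V, HasDerivAt (fun t : ℝ => H (p + t • w)) (Ω w (X p)) 0

/-- The curve `c` in the pre-phase space has derivative `v` at time `t`, in the Fréchet topology
given by the seminorms `sup_a (1 + a²)^((m + k)/2) |f⁽ᵏ⁾(a)|` of the two factors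
(`m = η` and `m = η + 1`). -/
def HasFrechetDerivAt {η : ℝ} (c : ℝ → PrePhase η) (v : PrePhase η) (t : ℝ) : Prop :=
  ∀ k : ℕ, ∀ ε > 0, ∀ᶠ h in 𝓝[≠] (0 : ℝ), ∀ a : ℝ,
    |iteratedDeriv k ((h⁻¹ • (c (t + h) - c t) - v).1 : ℝ → ℝ) a|
        ≤ ε * (1 + a ^ 2) ^ (-(η + k) / 2) ∧
      |iteratedDeriv k ((h⁻¹ • (c (t + h) - c t) - v).2 : ℝ → ℝ) a|
        ≤ ε * (1 + a ^ 2) ^ (-(η + 1 + k) / 2)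

/-- `U` is the (globally defined) flow of the Hamiltonian vector field of `H`. -/
def IsHamiltonianFlow {η : ℝ} (Ω : PrePhase η →ₗ[ℝ] PrePhase η →ₗ[ℝ] ℝ)
    (H : PrePhase η → ℝ) (U : ℝ → PrePhase η → PrePhase η) : Prop :=
  ∃ X : PrePhase η → PrePhase η, IsHamiltonianVectorField Ω H X ∧
    (∀ p, U 0 p = p) ∧ (∀ s t p, U (s + t) p = U s (U t p)) ∧
    ∀ t p, HasFrechetDerivAt (fun s => U s p) (X (U t p)) t

end MinkowskiStrip

end

/-!
On a solution `φ` of the wave equation the null currents `φ_n ± φ'` are transported along the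
characteristics, so in a space-like or time-like frame the evolution is a translation of the two
chiral profiles in d'Alembert's formula `F (a + t) + G (a - t)`. The profiles themselves need not
decay; only `F + G`, `F'` and `G'` do, and that is enough for the superposition to be a field and
for its difference quotients to converge in the Fréchet topology. In terms of the profiles `ω̃` is
the integral of the Wronskian of the `F`s minus that of the `G`s, up to the integral of a total
derivative, hence is translation invariant: the flow is symplectic, and the graph of a symplectic
bijection is Lagrangian.

In a light-like frame `g(τ, τ) = 0` removes `φ_n` from the presymplectic form, and the wave
equation becomes `∂_n ∂_τ φ = 0`. Hence `φ'`, and by decay `φ`, takes the same values on the two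
boundary lines, and a field constant along `n` realizes every point of the diagonal.
-/

noncomputable section

namespace MinkowskiStrip

open MeasureTheory Filter Set

/-! ### Decay on the line -/

/-- The decay `f = O(|a|^(-r))` at infinity, encoded as in `decaySpace` by a bound on the whole
line, which for `0 ≤ r` makes `f` bounded. -/
def HasDecay (r : ℝ) (f : ℝ → ℝ) : Prop :=
  ∃ C : ℝ, ∀ a : ℝ, |f a| ≤ C * (1 + a ^ 2) ^ (-r / 2)

theorem rpow_neg_le_of_le_mul {r K A B : ℝ} (hr : 0 ≤ r) (hK : 0 < K) (hA : 0 < A)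
    (h : A ≤ K * B) : B ^ (-r / 2) ≤ K ^ (r / 2) * A ^ (-r / 2) :=
  calc B ^ (-r / 2) ≤ (A / K) ^ (-r / 2) :=
        Real.rpow_le_rpow_of_nonpos (div_pos hA hK) (by rwa [div_le_iff₀' hK]) (by linarith)
    _ = K ^ (r / 2) * A ^ (-r / 2) := by
        rw [Real.div_rpow hA.le hK.le, neg_div, Real.rpow_neg hK.le, div_inv_eq_mul, mul_comm]

theorem one_add_sq_le_of_abs_sub_le {a x T : ℝ} (h : |x - a| ≤ T) :
    1 + a ^ 2 ≤ 2 * (1 + T ^ 2) * (1 + x ^ 2) := by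
  have hsq : (x - a) ^ 2 ≤ T ^ 2 := sq_le_sq' (abs_le.1 h).1 (abs_le.1 h).2
  nlinarith [sq_nonneg (2 * x - a), mul_nonneg (sq_nonneg T) (sq_nonneg x)]

section HasDecay

variable {r s : ℝ} {f g : ℝ → ℝ}

theorem HasDecay.exists_nonneg (hf : HasDecay r f) :
    ∃ C : ℝ, 0 ≤ C ∧ ∀ a : ℝ, |f a| ≤ C * (1 + a ^ 2) ^ (-r / 2) := by
  obtain ⟨C, hC⟩ := hf
  exact ⟨C, by simpa using (abs_nonneg _).trans (hC 0), hC⟩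

theorem HasDecay.mono (hrs : r ≤ s) (hf : HasDecay s f) : HasDecay r f := by
  obtain ⟨C, hC₀, hC⟩ := hf.exists_nonneg
  refine ⟨C, fun a => (hC a).trans (mul_le_mul_of_nonneg_left ?_ hC₀)⟩
  exact Real.rpow_le_rpow_of_exponent_le (by nlinarith [sq_nonneg a]) (by linarith)

theorem HasDecay.mul (hf : HasDecay r f) (hg : HasDecay s g) :
    HasDecay (r + s) fun a => f a * g a := by
  obtain ⟨C, hC₀, hC⟩ := hf.exists_nonneg
  obtain ⟨C', hC'⟩ := hg
  refine ⟨C * C', fun a => ?_⟩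
  rw [abs_mul, neg_add, add_div, Real.rpow_add (by positivity), mul_mul_mul_comm]
  gcongr
  exacts [hC a, hC' a]

theorem HasDecay.tendsto_cocompact (hr : 0 < r) (hf : HasDecay r f) :
    Tendsto f (cocompact ℝ) (𝓝 0) := by
  obtain ⟨C, hC⟩ := hf
  have hsq : Tendsto (fun a : ℝ => 1 + a ^ 2) (cocompact ℝ) atTop := by
    simpa only [Function.comp_def, Real.norm_eq_abs, sq_abs] using
      tendsto_atTop_add_const_left _ (1 : ℝ)
        ((tendsto_pow_atTop two_ne_zero).comp (tendsto_norm_cocompact_atTop (E := ℝ)))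
  refine squeeze_zero_norm hC ?_
  simpa only [Function.comp_def, mul_zero, neg_div] using
    ((tendsto_rpow_neg_atTop (half_pos hr)).comp hsq).const_mul C

theorem HasDecay.exists_bound_near (hr : 0 ≤ r) (hf : HasDecay r f) (T : ℝ) :
    ∃ C : ℝ, 0 ≤ C ∧ ∀ a x : ℝ, |x - a| ≤ T → |f x| ≤ C * (1 + a ^ 2) ^ (-r / 2) := by
  obtain ⟨C, hC₀, hC⟩ := hf.exists_nonneg
  refine ⟨C * (2 * (1 + T ^ 2)) ^ (r / 2), by positivity, fun a x h => (hC x).trans ?_⟩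
  rw [mul_assoc]
  exact mul_le_mul_of_nonneg_left (rpow_neg_le_of_le_mul hr (by positivity) (by positivity)
    (one_add_sq_le_of_abs_sub_le h)) hC₀

theorem HasDecay.comp_add_const (hr : 0 ≤ r) (hf : HasDecay r f) (t : ℝ) :
    HasDecay r fun a => f (a + t) := by
  obtain ⟨C, -, hC⟩ := hf.exists_bound_near hr |t|
  exact ⟨C, fun a => hC a (a + t) (by simp)⟩

theorem HasDecay.exists_lipschitz_near (hr : 0 ≤ r) (hf : Differentiable ℝ f)
    (hf' : HasDecay r (deriv f)) (T : ℝ) :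
    ∃ C : ℝ, 0 ≤ C ∧ ∀ a x y : ℝ, |x - a| ≤ T → |y - a| ≤ T →
      |f x - f y| ≤ C * (1 + a ^ 2) ^ (-r / 2) * |x - y| := by
  obtain ⟨C, hC₀, hC⟩ := hf'.exists_bound_near hr T
  refine ⟨C, hC₀, fun a x y hx hy => ?_⟩
  exact (convex_closedBall a T).norm_image_sub_le_of_norm_deriv_le (fun z _ => hf z)
    (fun z hz => hC a z (by simpa [Real.dist_eq] using hz))
    (by simpa [Real.dist_eq] using hy) (by simpa [Real.dist_eq] using hx)

theorem HasDecay.integrable (hr : 1 < r) (hf : Continuous f) (hf' : HasDecay r f) :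
    Integrable f := by
  have hone : HasDecay 0 fun _ => (1 : ℝ) := ⟨1, fun a => by simp⟩
  simpa only [mul_one] using
    integrable_mul_of_decay (by rwa [add_zero]) hf continuous_const hf' hone

theorem hasDecay_zero_of_deriv (hr : 1 < r) (hf : ContDiff ℝ 1 f) (hf' : HasDecay r (deriv f)) :
    HasDecay 0 f := by
  have hint : Integrable (deriv f) := hf'.integrable hr (hf.continuous_deriv le_rfl)
  refine ⟨|f 0| + ∫ x, ‖deriv f x‖, fun a => ?_⟩
  have hsub : f a - f 0 = ∫ x in (0 : ℝ)..a, deriv f x :=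
    (intervalIntegral.integral_deriv_eq_sub
      (fun x _ => hf.differentiable one_ne_zero x) hint.intervalIntegrable).symm
  have hle : |f a - f 0| ≤ ∫ x, ‖deriv f x‖ := by
    rw [hsub, ← Real.norm_eq_abs]
    exact intervalIntegral.norm_integral_le_integral_norm_uIoc.trans
      (setIntegral_le_integral hint.norm (Eventually.of_forall fun x => norm_nonneg _))
  simpa using (sub_le_iff_le_add'.1 ((abs_sub_abs_le_abs_sub _ _).trans hle))

end HasDecay

section DecaySpace

variable {m m' : ℝ} {f g : ℝ → ℝ}

theorem hasDecay_of_mem (hf : f ∈ decaySpace m) : HasDecay m f := by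
  simpa [HasDecay] using hf.2 0

theorem deriv_mem_decaySpace (hf : f ∈ decaySpace m) : deriv f ∈ decaySpace (m + 1) := by
  refine ⟨(contDiff_infty_iff_deriv.1 hf.1).2, fun k => ?_⟩
  simpa only [iteratedDeriv_succ', Nat.cast_succ, add_assoc, add_comm (k : ℝ)] using hf.2 (k + 1)

theorem mem_decaySpace_of_deriv (hf : Differentiable ℝ f) (hf₀ : HasDecay m f)
    (hf' : deriv f ∈ decaySpace (m + 1)) : f ∈ decaySpace m := by
  refine ⟨contDiff_infty_iff_deriv.2 ⟨hf, hf'.1⟩, fun k => ?_⟩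
  cases k with
  | zero => simpa [HasDecay] using hf₀
  | succ k =>
    simpa only [iteratedDeriv_succ', Nat.cast_succ, add_assoc, add_comm (k : ℝ)] using hf'.2 k

theorem decaySpace_antitone : Antitone decaySpace := fun _ _ hmm' _ hf =>
  ⟨hf.1, fun k => HasDecay.mono (by linarith) (hf.2 k)⟩

theorem comp_add_const_mem_decaySpace (hm : 0 ≤ m) (hf : f ∈ decaySpace m) (t : ℝ) :
    (fun a => f (a + t)) ∈ decaySpace m := by
  refine ⟨hf.1.comp (contDiff_id.add contDiff_const), fun k => ?_⟩
  rw [iteratedDeriv_comp_add_const]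
  exact HasDecay.comp_add_const (by positivity) (hf.2 k) t

theorem eq_of_deriv_eq (hm : 0 < m) (hf : f ∈ decaySpace m) (hg : g ∈ decaySpace m)
    (h : deriv f = deriv g) : f = g := by
  have hfg : f - g ∈ decaySpace m := (decaySpace m).sub_mem hf hg
  have hconst : ∀ x y, (f - g) x = (f - g) y :=
    is_const_of_deriv_eq_zero (hfg.1.differentiable (by simp)) fun a => by
      rw [deriv_sub (hf.1.differentiable (by simp) a) (hg.1.differentiable (by simp) a), h,
        sub_self]
  refine sub_eq_zero.1
    (funext fun a => tendsto_nhds_unique (l := cocompact ℝ) tendsto_const_nhds ?_)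
  exact ((hasDecay_of_mem hfg).tendsto_cocompact hm).congr fun x => hconst x a

theorem mem_decaySpace_of_hasCompactSupport (hf : ContDiff ℝ ∞ f) (hc : HasCompactSupport f) :
    f ∈ decaySpace m := by
  refine ⟨hf, fun k => ?_⟩
  have hsupp : HasCompactSupport (iteratedDeriv k f) := by
    refine (hc.iteratedFDeriv (𝕜 := ℝ) k).mono fun x hx => ?_
    rw [Function.mem_support, iteratedDeriv_eq_iteratedFDeriv] at hx
    exact fun h => hx (by simp [h])
  have hcont : Continuous fun a => iteratedDeriv k f a * (1 + a ^ 2) ^ ((m + k) / 2) :=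
    (hf.continuous_iteratedDeriv k (by exact_mod_cast le_top)).mul
      (Continuous.rpow_const (by fun_prop) fun a => Or.inl (by positivity))
  obtain ⟨C, hC⟩ := hsupp.mul_right.exists_bound_of_continuous hcont
  refine ⟨C, fun a => ?_⟩
  have hw : 0 < (1 + a ^ 2) ^ ((m + k) / 2) := by positivity
  rw [neg_div, Real.rpow_neg (by positivity), ← div_eq_mul_inv, le_div_iff₀ hw]
  simpa only [Pi.mul_apply, norm_mul, Real.norm_eq_abs, abs_of_pos hw] using hC a

theorem eq_zero_of_forall_integral_mul_eq_zero (hf : Continuous f)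
    (h : ∀ g ∈ decaySpace m, ∫ a, f a * g a = 0) : f = 0 := by
  refine (Continuous.ae_eq_iff_eq volume hf continuous_zero).1
    (ae_eq_zero_of_integral_contDiff_smul_eq_zero hf.locallyIntegrable fun g hg hgc => ?_)
  simpa only [smul_eq_mul, mul_comm] using h g (mem_decaySpace_of_hasCompactSupport hg hgc)

theorem integrable_mul_of_mem (h : 1 < m + m') (hf : f ∈ decaySpace m)
    (hg : g ∈ decaySpace m') : Integrable fun a => f a * g a :=
  integrable_mul_of_decay h hf.1.continuous hg.1.continuous (hasDecay_of_mem hf)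
    (hasDecay_of_mem hg)

theorem integral_deriv_mul_eq_neg (h : 0 < m + m') (hf : f ∈ decaySpace m)
    (hg : g ∈ decaySpace m') : ∫ a, deriv f a * g a = -∫ a, f a * deriv g a := by
  have hlim : Tendsto (f * g) (cocompact ℝ) (𝓝 0) :=
    ((hasDecay_of_mem hf).mul (hasDecay_of_mem hg)).tendsto_cocompact h
  have hparts := integral_mul_deriv_eq_deriv_mul
    (fun a _ => (hf.1.differentiable (by simp) a).hasDerivAt)
    (fun a _ => (hg.1.differentiable (by simp) a).hasDerivAt)
    (integrable_mul_of_mem (by linarith) hf (deriv_mem_decaySpace hg))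
    (integrable_mul_of_mem (by linarith) (deriv_mem_decaySpace hf) hg)
    (hlim.mono_left atBot_le_cocompact) (hlim.mono_left atTop_le_cocompact)
  linarith

end DecaySpace

/-! ### Superpositions of travelling waves -/

/-- The superposition at time `t` of the profile `F` travelling towards decreasing `a` and the
profile `G` travelling towards increasing `a`. -/
def wave (F G : ℝ → ℝ) (t a : ℝ) : ℝ := F (a + t) + G (a - t)

/-- Profiles whose superpositions lie in `decaySpace m`. The profiles themselves need not decay:
only their derivatives and their sum do. -/
structure IsWavePair (m : ℝ) (F G : ℝ → ℝ) : Prop where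
  contDiff_left : ContDiff ℝ ∞ F
  contDiff_right : ContDiff ℝ ∞ G
  deriv_left_mem : deriv F ∈ decaySpace (m + 1)
  deriv_right_mem : deriv G ∈ decaySpace (m + 1)
  add_mem : F + G ∈ decaySpace m

/-- The failure of the difference quotient of `f` with increment `h` to equal the derivative. -/
def slopeError (f : ℝ → ℝ) (h a : ℝ) : ℝ := h⁻¹ * (f (a + h) - f a) - deriv f a

/-- The Wronskian of two profiles, with the sign that makes it the density of `ω̃`. -/
def wronskian (f g : ℝ → ℝ) (a : ℝ) : ℝ := deriv f a * g a - deriv g a * f a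

section Smooth

variable {F G : ℝ → ℝ}

theorem contDiff_wave (hF : ContDiff ℝ ∞ F) (hG : ContDiff ℝ ∞ G) (t : ℝ) :
    ContDiff ℝ ∞ (wave F G t) :=
  (hF.comp (by fun_prop)).add (hG.comp (by fun_prop))

theorem iteratedDeriv_wave (hF : ContDiff ℝ ∞ F) (hG : ContDiff ℝ ∞ G) (k : ℕ) (t : ℝ) :
    iteratedDeriv k (wave F G t) = wave (iteratedDeriv k F) (iteratedDeriv k G) t := by
  have hk : (k : WithTop ℕ∞) ≤ ∞ := by exact_mod_cast le_top
  have hF' : ContDiff ℝ k fun a => F (a + t) := (hF.of_le hk).comp (by fun_prop)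
  have hG' : ContDiff ℝ k fun a => G (a - t) := (hG.of_le hk).comp (by fun_prop)
  funext a
  calc iteratedDeriv k (wave F G t) a
      = iteratedDeriv k (fun a => F (a + t)) a + iteratedDeriv k (fun a => G (a - t)) a :=
        iteratedDeriv_fun_add hF'.contDiffAt hG'.contDiffAt
    _ = wave (iteratedDeriv k F) (iteratedDeriv k G) t a := by
        rw [iteratedDeriv_comp_add_const, iteratedDeriv_comp_sub_const, wave]

theorem deriv_wave (hF : ContDiff ℝ ∞ F) (hG : ContDiff ℝ ∞ G) (t : ℝ) :
    deriv (wave F G t) = wave (deriv F) (deriv G) t := by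
  simpa only [iteratedDeriv_one] using iteratedDeriv_wave hF hG 1 t

theorem contDiff_slopeError (hF : ContDiff ℝ ∞ F) (h : ℝ) : ContDiff ℝ ∞ (slopeError F h) :=
  (contDiff_const.mul ((hF.comp (by fun_prop)).sub hF)).sub (contDiff_infty_iff_deriv.1 hF).2

theorem deriv_slopeError (hF : ContDiff ℝ ∞ F) (h : ℝ) :
    deriv (slopeError F h) = slopeError (deriv F) h := by
  have hF₁ : ContDiff ℝ ∞ (deriv F) := (contDiff_infty_iff_deriv.1 hF).2
  funext a
  exact (((((hF.differentiable (by simp) (a + h)).hasDerivAt.comp_add_const a h).sub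
    (hF.differentiable (by simp) a).hasDerivAt).const_mul h⁻¹).sub
    (hF₁.differentiable (by simp) a).hasDerivAt).deriv

theorem iteratedDeriv_slopeError (hF : ContDiff ℝ ∞ F) (k : ℕ) (h : ℝ) :
    iteratedDeriv k (slopeError F h) = slopeError (iteratedDeriv k F) h := by
  induction k generalizing F with
  | zero => simp only [iteratedDeriv_zero]
  | succ k ih =>
    rw [iteratedDeriv_succ', iteratedDeriv_succ', deriv_slopeError hF,
      ih (contDiff_infty_iff_deriv.1 hF).2]

theorem slope_wave_sub (F G : ℝ → ℝ) (t h : ℝ) :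
    h⁻¹ • (wave F G (t + h) - wave F G t) - wave (deriv F) (-deriv G) t =
      wave (slopeError F h) (-slopeError G (-h)) t := by
  funext a
  simp only [wave, slopeError, Pi.sub_apply, Pi.smul_apply, Pi.neg_apply, smul_eq_mul, inv_neg,
    show a + (t + h) = a + t + h by ring, show a - (t + h) = a - t + -h by ring]
  ring

end Smooth

theorem abs_slopeError_le {f : ℝ → ℝ} (hf : Differentiable ℝ f) (hf' : Differentiable ℝ (deriv f))
    {x h B : ℝ} (hh : h ≠ 0) (hB : ∀ y, |y - x| ≤ |h| → |deriv (deriv f) y| ≤ B) :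
    |slopeError f h x| ≤ B * |h| := by
  have hball : ∀ y, y ∈ Metric.closedBall x |h| ↔ |y - x| ≤ |h| := fun y => by
    rw [Metric.mem_closedBall, Real.dist_eq]
  have hx : x ∈ Metric.closedBall x |h| := Metric.mem_closedBall_self (abs_nonneg h)
  have hderiv : ∀ y ∈ Metric.closedBall x |h|, ‖deriv f y - deriv f x‖ ≤ B * |h| := fun y hy =>
    ((convex_closedBall x |h|).norm_image_sub_le_of_norm_deriv_le (fun z _ => hf' z)
      (fun z hz => hB z ((hball z).1 hz)) hx hy).trans
      (mul_le_mul_of_nonneg_left ((hball y).1 hy)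
        ((abs_nonneg _).trans (hB x (by simp))))
  have htaylor := (convex_closedBall x |h|).norm_image_sub_le_of_norm_hasDerivWithin_le
    (f := fun y => f y - deriv f x * y) (f' := fun y => deriv f y - deriv f x)
    (fun y _ => by simpa using ((hf y).hasDerivAt.fun_sub
      ((hasDerivAt_id' y).const_mul (deriv f x))).hasDerivWithinAt)
    hderiv hx ((hball (x + h)).2 (by simp))
  have hslope : slopeError f h x =
      h⁻¹ * (f (x + h) - deriv f x * (x + h) - (f x - deriv f x * x)) := by
    rw [slopeError]; field_simp; ring
  rw [add_sub_cancel_left] at htaylor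
  rw [hslope, abs_mul, abs_inv, inv_mul_le_iff₀ (abs_pos.2 hh), mul_comm |h|]
  exact htaylor

theorem HasDecay.eventually_abs_slopeError_le {r : ℝ} {f : ℝ → ℝ} (hr : 0 ≤ r)
    (hf : Differentiable ℝ f) (hf' : Differentiable ℝ (deriv f))
    (hf'' : HasDecay r (deriv (deriv f))) (t : ℝ) {ε : ℝ} (hε : 0 < ε) :
    ∀ᶠ h in 𝓝[≠] (0 : ℝ), ∀ a : ℝ, |slopeError f h (a + t)| ≤ ε * (1 + a ^ 2) ^ (-r / 2) := by
  obtain ⟨C, -, hC⟩ := hf''.exists_bound_near hr (|t| + 1)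
  have habs : Tendsto (fun h : ℝ => |h|) (𝓝[≠] 0) (𝓝 0) := by
    simpa using (continuous_abs.tendsto (0 : ℝ)).mono_left nhdsWithin_le_nhds
  have hCabs : Tendsto (fun h : ℝ => C * |h|) (𝓝[≠] 0) (𝓝 0) := by
    simpa using habs.const_mul C
  filter_upwards [hCabs.eventually_lt_const hε, habs.eventually_lt_const one_pos,
    self_mem_nhdsWithin] with h hCh hh₁ hh₀ a
  have hnear : ∀ y, |y - (a + t)| ≤ |h| → |y - a| ≤ |t| + 1 := fun y hy => by
    rw [show y - a = (y - (a + t)) + t by ring]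
    linarith [abs_add_le (y - (a + t)) t]
  calc |slopeError f h (a + t)| ≤ C * (1 + a ^ 2) ^ (-r / 2) * |h| :=
        abs_slopeError_le hf hf' hh₀ fun y hy => hC a y (hnear y hy)
    _ = C * |h| * (1 + a ^ 2) ^ (-r / 2) := by ring
    _ ≤ ε * (1 + a ^ 2) ^ (-r / 2) := by gcongr

theorem eventually_abs_iteratedDeriv_slopeError_le {m : ℝ} (hm : 0 ≤ m) {f : ℝ → ℝ}
    (hf : ContDiff ℝ ∞ f) (hf' : deriv f ∈ decaySpace (m + 1)) (k : ℕ) (t : ℝ) {ε : ℝ}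
    (hε : 0 < ε) : ∀ᶠ h in 𝓝[≠] (0 : ℝ), ∀ a : ℝ,
      |iteratedDeriv k (slopeError f h) (a + t)| ≤ ε * (1 + a ^ 2) ^ (-(m + k) / 2) := by
  have hsmooth : ∀ j : ℕ, Differentiable ℝ (iteratedDeriv j f) := fun j =>
    hf.differentiable_iteratedDeriv j (by exact_mod_cast WithTop.coe_lt_top _)
  have hdecay : HasDecay (m + k) (deriv (deriv (iteratedDeriv k f))) := by
    rw [← iteratedDeriv_succ, ← iteratedDeriv_succ, iteratedDeriv_succ']
    exact HasDecay.mono (by push_cast; linarith) (hf'.2 (k + 1))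
  refine (hdecay.eventually_abs_slopeError_le (by positivity) (hsmooth k)
    (iteratedDeriv_succ (f := f) (n := k) ▸ hsmooth (k + 1)) t hε).mono fun h hh a => ?_
  rw [iteratedDeriv_slopeError hf]
  exact hh a

theorem integrable_wronskian {m : ℝ} (hm : 0 < m) {f g : ℝ → ℝ} (hf : ContDiff ℝ ∞ f)
    (hg : ContDiff ℝ ∞ g) (hf' : deriv f ∈ decaySpace (m + 1))
    (hg' : deriv g ∈ decaySpace (m + 1)) : Integrable (wronskian f g) := by
  have hbounded {f : ℝ → ℝ} (hf : ContDiff ℝ ∞ f) (hf' : deriv f ∈ decaySpace (m + 1)) :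
      HasDecay 0 f :=
    hasDecay_zero_of_deriv (by linarith) (hf.of_le (by simp)) (hasDecay_of_mem hf')
  exact (integrable_mul_of_decay (by linarith) hf'.1.continuous hg.continuous
    (hasDecay_of_mem hf') (hbounded hg hg')).sub
    (integrable_mul_of_decay (by linarith) hg'.1.continuous hf.continuous
    (hasDecay_of_mem hg') (hbounded hf hf'))

theorem hasDerivAt_mul_sub_mul {F G F₁ G₁ : ℝ → ℝ} (hF : Differentiable ℝ F)
    (hG : Differentiable ℝ G) (hF₁ : Differentiable ℝ F₁) (hG₁ : Differentiable ℝ G₁) (t a : ℝ) :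
    HasDerivAt (fun a => F (a + t) * G₁ (a - t) - F₁ (a + t) * G (a - t))
      (wave (deriv F) (-deriv G) t a * wave F₁ G₁ t a
        - wave (deriv F₁) (-deriv G₁) t a * wave F G t a
        - (wronskian F F₁ (a + t) - wronskian G G₁ (a - t))) a := by
  refine ((((hF (a + t)).hasDerivAt.comp_add_const a t).fun_mul
    ((hG₁ (a - t)).hasDerivAt.comp_sub_const a t)).fun_sub
    (((hF₁ (a + t)).hasDerivAt.comp_add_const a t).fun_mul
    ((hG (a - t)).hasDerivAt.comp_sub_const a t))).congr_deriv ?_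
  simp only [wave, wronskian, Pi.neg_apply]
  ring

namespace IsWavePair

variable {m : ℝ} {F G F₁ G₁ : ℝ → ℝ}

theorem of_mem (hF : F ∈ decaySpace m) (hG : G ∈ decaySpace m) : IsWavePair m F G :=
  ⟨hF.1, hG.1, deriv_mem_decaySpace hF, deriv_mem_decaySpace hG, (decaySpace m).add_mem hF hG⟩

theorem derivs_neg (h : IsWavePair m F G) : IsWavePair (m + 1) (deriv F) (-deriv G) :=
  of_mem h.deriv_left_mem ((decaySpace _).neg_mem h.deriv_right_mem)

theorem exists_bound_add (hm : 0 ≤ m) (h : IsWavePair m F G) {T : ℝ} (hT : 0 ≤ T) :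
    ∃ C : ℝ, ∀ a x y : ℝ, |x - a| ≤ T → |y - a| ≤ T →
      |F x + G y| ≤ C * (1 + a ^ 2) ^ (-m / 2) := by
  have hlip {f : ℝ → ℝ} (hf : ContDiff ℝ ∞ f) (hf' : deriv f ∈ decaySpace (m + 1)) :
      ∃ C : ℝ, ∀ a x : ℝ, |x - a| ≤ T → |f x - f a| ≤ C * (1 + a ^ 2) ^ (-m / 2) := by
    obtain ⟨C, hC₀, hC⟩ := HasDecay.exists_lipschitz_near hm (hf.differentiable (by simp))
      ((hasDecay_of_mem hf').mono (by linarith)) T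
    refine ⟨C * T, fun a x hx => (hC a x a hx (by simpa using hT)).trans ?_⟩
    rw [mul_right_comm]
    gcongr
  obtain ⟨C, hC⟩ := hasDecay_of_mem h.add_mem
  obtain ⟨C₁, hC₁⟩ := hlip h.contDiff_left h.deriv_left_mem
  obtain ⟨C₂, hC₂⟩ := hlip h.contDiff_right h.deriv_right_mem
  refine ⟨C + C₁ + C₂, fun a x y hx hy => ?_⟩
  rw [show F x + G y = (F + G) a + (F x - F a) + (G y - G a) by rw [Pi.add_apply]; ring,
    add_mul, add_mul]
  exact (abs_add_three _ _ _).trans (add_le_add_three (hC a) (hC₁ a x hx) (hC₂ a y hy))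

theorem wave_mem (hm : 0 ≤ m) (h : IsWavePair m F G) (t : ℝ) : wave F G t ∈ decaySpace m := by
  refine mem_decaySpace_of_deriv
    ((contDiff_wave h.contDiff_left h.contDiff_right t).differentiable (by simp)) ?_ ?_
  · obtain ⟨C, hC⟩ := h.exists_bound_add hm (abs_nonneg t)
    exact ⟨C, fun a => hC a _ _ (by simp) (by simp)⟩
  · rw [deriv_wave h.contDiff_left h.contDiff_right]
    exact (decaySpace _).add_mem (comp_add_const_mem_decaySpace (by linarith) h.deriv_left_mem t)
      (comp_add_const_mem_decaySpace (by linarith) h.deriv_right_mem (-t))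

theorem eventually_abs_slope_sub_le (hm : 0 ≤ m) (hw : IsWavePair m F G) (k : ℕ) (t : ℝ)
    {ε : ℝ} (hε : 0 < ε) : ∀ᶠ h in 𝓝[≠] (0 : ℝ), ∀ a : ℝ,
      |iteratedDeriv k (h⁻¹ • (wave F G (t + h) - wave F G t)
        - wave (deriv F) (-deriv G) t) a| ≤ ε * (1 + a ^ 2) ^ (-(m + k) / 2) := by
  have hneg : Tendsto (fun h : ℝ => -h) (𝓝[≠] 0) (𝓝[≠] 0) := by
    refine tendsto_nhdsWithin_iff.2
      ⟨by simpa using (continuous_neg.tendsto (0 : ℝ)).mono_left nhdsWithin_le_nhds, ?_⟩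
    filter_upwards [self_mem_nhdsWithin] with h hh using neg_ne_zero.2 hh
  filter_upwards [eventually_abs_iteratedDeriv_slopeError_le hm hw.contDiff_left
      hw.deriv_left_mem k t (half_pos hε),
    hneg.eventually (eventually_abs_iteratedDeriv_slopeError_le hm hw.contDiff_right
      hw.deriv_right_mem k (-t) (half_pos hε))] with h hleft hright a
  rw [slope_wave_sub, iteratedDeriv_wave (G := -slopeError G (-h))
    (contDiff_slopeError hw.contDiff_left h) (contDiff_slopeError hw.contDiff_right (-h)).neg,
    wave, iteratedDeriv_neg, ← sub_eq_add_neg, sub_eq_add_neg a t]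
  refine (abs_sub _ _).trans ((add_le_add (hleft a) (hright a)).trans (le_of_eq ?_))
  ring

theorem tendsto_mul_sub_mul (hm : 0 < m) (h : IsWavePair m F G) (h₁ : IsWavePair m F₁ G₁)
    (t : ℝ) :
    Tendsto (fun a => F (a + t) * G₁ (a - t) - F₁ (a + t) * G (a - t)) (cocompact ℝ) (𝓝 0) := by
  have hlim {F G F₁ G₁ : ℝ → ℝ} (h : IsWavePair m F G) (h₁ : IsWavePair m F₁ G₁) :
      Tendsto (fun a => F (a + t) * wave F₁ G₁ t a) (cocompact ℝ) (𝓝 0) := by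
    have hF : HasDecay 0 F := hasDecay_zero_of_deriv (by linarith)
      (h.contDiff_left.of_le (by simp)) (hasDecay_of_mem h.deriv_left_mem)
    exact ((hF.comp_add_const le_rfl t).mul
      (hasDecay_of_mem (h₁.wave_mem hm.le t))).tendsto_cocompact (by linarith)
  refine (sub_zero (0 : ℝ) ▸ (hlim h h₁).sub (hlim h₁ h)).congr fun a => ?_
  simp only [wave]
  ring

theorem integral_wave_mul_wave_sub (hm : 0 < m) (h : IsWavePair m F G)
    (h₁ : IsWavePair m F₁ G₁) (t : ℝ) :
    ∫ a, (wave (deriv F) (-deriv G) t a * wave F₁ G₁ t a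
      - wave (deriv F₁) (-deriv G₁) t a * wave F G t a) =
      (∫ a, wronskian F F₁ a) - ∫ a, wronskian G G₁ a := by
  have hdiff {f : ℝ → ℝ} (hf : ContDiff ℝ ∞ f) : Differentiable ℝ f := hf.differentiable (by simp)
  have hdensity : Integrable fun a => wave (deriv F) (-deriv G) t a * wave F₁ G₁ t a
      - wave (deriv F₁) (-deriv G₁) t a * wave F G t a :=
    (integrable_mul_of_mem (by linarith) (h.derivs_neg.wave_mem (by linarith) t)
      (h₁.wave_mem hm.le t)).sub
    (integrable_mul_of_mem (by linarith) (h₁.derivs_neg.wave_mem (by linarith) t)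
      (h.wave_mem hm.le t))
  have hleft := (integrable_wronskian hm h.contDiff_left h₁.contDiff_left h.deriv_left_mem
    h₁.deriv_left_mem).comp_add_right t
  have hright := (integrable_wronskian hm h.contDiff_right h₁.contDiff_right h.deriv_right_mem
    h₁.deriv_right_mem).comp_sub_right t
  have hwronskian : Integrable fun a => wronskian F F₁ (a + t) - wronskian G G₁ (a - t) :=
    hleft.sub hright
  have hlim := h.tendsto_mul_sub_mul hm h₁ t
  have hcross := integral_of_hasDerivAt_of_tendsto
    (hasDerivAt_mul_sub_mul (hdiff h.contDiff_left) (hdiff h.contDiff_right)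
      (hdiff h₁.contDiff_left) (hdiff h₁.contDiff_right) t)
    (hdensity.sub hwronskian)
    (hlim.mono_left atBot_le_cocompact) (hlim.mono_left atTop_le_cocompact)
  rw [integral_sub hdensity hwronskian, integral_sub hleft hright,
    integral_add_right_eq_self (wronskian F F₁), integral_sub_right_eq_self (wronskian G G₁),
    sub_self] at hcross
  exact sub_eq_zero.1 hcross

end IsWavePair

/-! ### The flow of the wave equation -/

section Flow

variable {η : ℝ}

/-- The null current `φ_n + φ'` of the data `p = (φ, φ_n)`, which the wave equation transports
towards decreasing `a`. -/
def leftCurrent (p : PrePhase η) : ℝ → ℝ := (p.2 : ℝ → ℝ) + deriv (p.1 : ℝ → ℝ)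

/-- The null current `φ_n - φ'` of the data `p = (φ, φ_n)`, which the wave equation transports
towards increasing `a`. -/
def rightCurrent (p : PrePhase η) : ℝ → ℝ := (p.2 : ℝ → ℝ) - deriv (p.1 : ℝ → ℝ)

/-- The profile `F` in d'Alembert's solution `F (a + t) + G (a - t)`, normalized at `a = 0`. -/
def leftMover (p : PrePhase η) (a : ℝ) : ℝ :=
  2⁻¹ * ((p.1 : ℝ → ℝ) a + ∫ x in (0 : ℝ)..a, (p.2 : ℝ → ℝ) x)

/-- The profile `G` in d'Alembert's solution `F (a + t) + G (a - t)`, normalized at `a = 0`. -/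
def rightMover (p : PrePhase η) (a : ℝ) : ℝ :=
  2⁻¹ * ((p.1 : ℝ → ℝ) a - ∫ x in (0 : ℝ)..a, (p.2 : ℝ → ℝ) x)

theorem prePhase_ext {p q : PrePhase η} (h₁ : (p.1 : ℝ → ℝ) = q.1) (h₂ : (p.2 : ℝ → ℝ) = q.2) :
    p = q :=
  Prod.ext (Subtype.ext h₁) (Subtype.ext h₂)

theorem prePhase_ext_of_currents (hη : 0 < η) {p q : PrePhase η}
    (hleft : leftCurrent p = leftCurrent q) (hright : rightCurrent p = rightCurrent q) :
    p = q := by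
  refine prePhase_ext (eq_of_deriv_eq hη p.1.2 q.1.2 (funext fun a => ?_)) (funext fun a => ?_)
  all_goals
    have hl := congrFun hleft a
    have hr := congrFun hright a
    simp only [leftCurrent, rightCurrent, Pi.add_apply, Pi.sub_apply] at hl hr
    linarith

theorem leftCurrent_mem (p : PrePhase η) : leftCurrent p ∈ decaySpace (η + 1) :=
  (decaySpace _).add_mem p.2.2 (deriv_mem_decaySpace p.1.2)

theorem rightCurrent_mem (p : PrePhase η) : rightCurrent p ∈ decaySpace (η + 1) :=
  (decaySpace _).sub_mem p.2.2 (deriv_mem_decaySpace p.1.2)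

theorem leftMover_add_rightMover (p : PrePhase η) :
    leftMover p + rightMover p = (p.1 : ℝ → ℝ) := by
  funext a
  simp only [Pi.add_apply, leftMover, rightMover]
  ring

theorem hasDerivAt_leftMover (p : PrePhase η) (a : ℝ) :
    HasDerivAt (leftMover p) (2⁻¹ * leftCurrent p a) a :=
  (((differentiable_of_mem p.1 a).hasDerivAt.add
    (p.2.2.1.continuous.integral_hasStrictDerivAt 0 a).hasDerivAt).const_mul 2⁻¹).congr_deriv
    (by rw [leftCurrent, Pi.add_apply, add_comm])

theorem hasDerivAt_rightMover (p : PrePhase η) (a : ℝ) :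
    HasDerivAt (rightMover p) (-2⁻¹ * rightCurrent p a) a :=
  (((differentiable_of_mem p.1 a).hasDerivAt.sub
    (p.2.2.1.continuous.integral_hasStrictDerivAt 0 a).hasDerivAt).const_mul 2⁻¹).congr_deriv
    (by rw [rightCurrent, Pi.sub_apply]; ring)

theorem deriv_leftMover (p : PrePhase η) : deriv (leftMover p) = (2⁻¹ : ℝ) • leftCurrent p :=
  funext fun a => (hasDerivAt_leftMover p a).deriv

theorem deriv_rightMover (p : PrePhase η) :
    deriv (rightMover p) = (-2⁻¹ : ℝ) • rightCurrent p :=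
  funext fun a => (hasDerivAt_rightMover p a).deriv

theorem isWavePair_movers (p : PrePhase η) : IsWavePair η (leftMover p) (rightMover p) := by
  have hleft : deriv (leftMover p) ∈ decaySpace (η + 1) :=
    deriv_leftMover p ▸ (decaySpace _).smul_mem _ (leftCurrent_mem p)
  have hright : deriv (rightMover p) ∈ decaySpace (η + 1) :=
    deriv_rightMover p ▸ (decaySpace _).smul_mem _ (rightCurrent_mem p)
  exact ⟨contDiff_infty_iff_deriv.2 ⟨fun a => (hasDerivAt_leftMover p a).differentiableAt, hleft.1⟩,
    contDiff_infty_iff_deriv.2 ⟨fun a => (hasDerivAt_rightMover p a).differentiableAt, hright.1⟩,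
    hleft, hright, leftMover_add_rightMover p ▸ p.1.2⟩

/-- The time `t` evolution of the data `(φ, φ_n)` under the wave equation, by d'Alembert's
formula. -/
def waveFlow (hη : 0 < η) (t : ℝ) (p : PrePhase η) : PrePhase η :=
  (⟨wave (leftMover p) (rightMover p) t, (isWavePair_movers p).wave_mem hη.le t⟩,
    ⟨wave (deriv (leftMover p)) (-deriv (rightMover p)) t,
      (isWavePair_movers p).derivs_neg.wave_mem (by linarith) t⟩)

/-- The vector field `(φ, π) ↦ (π, φ'')`. -/
def waveField (p : PrePhase η) : PrePhase η :=
  (⟨p.2, decaySpace_antitone (by linarith) p.2.2⟩,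
    ⟨deriv (deriv (p.1 : ℝ → ℝ)), decaySpace_antitone (by linarith)
      (deriv_mem_decaySpace (deriv_mem_decaySpace p.1.2))⟩)

theorem waveFlow_fst (hη : 0 < η) (t : ℝ) (p : PrePhase η) :
    ((waveFlow hη t p).1 : ℝ → ℝ) = wave (leftMover p) (rightMover p) t := rfl

theorem waveFlow_snd (hη : 0 < η) (t : ℝ) (p : PrePhase η) :
    ((waveFlow hη t p).2 : ℝ → ℝ) =
      wave (deriv (leftMover p)) (-deriv (rightMover p)) t := rfl

theorem deriv_waveFlow_fst (hη : 0 < η) (t : ℝ) (p : PrePhase η) :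
    deriv ((waveFlow hη t p).1 : ℝ → ℝ) =
      wave (deriv (leftMover p)) (deriv (rightMover p)) t :=
  deriv_wave (isWavePair_movers p).contDiff_left (isWavePair_movers p).contDiff_right t

theorem leftCurrent_waveFlow (hη : 0 < η) (t : ℝ) (p : PrePhase η) (a : ℝ) :
    leftCurrent (waveFlow hη t p) a = leftCurrent p (a + t) := by
  rw [leftCurrent, waveFlow_snd, deriv_waveFlow_fst, deriv_leftMover, deriv_rightMover]
  simp only [wave, Pi.add_apply, Pi.neg_apply, Pi.smul_apply, smul_eq_mul]
  ring

theorem rightCurrent_waveFlow (hη : 0 < η) (t : ℝ) (p : PrePhase η) (a : ℝ) :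
    rightCurrent (waveFlow hη t p) a = rightCurrent p (a - t) := by
  rw [rightCurrent, waveFlow_snd, deriv_waveFlow_fst, deriv_leftMover, deriv_rightMover]
  simp only [wave, Pi.sub_apply, Pi.neg_apply, Pi.smul_apply, smul_eq_mul]
  ring

theorem waveFlow_zero (hη : 0 < η) (p : PrePhase η) : waveFlow hη 0 p = p :=
  prePhase_ext_of_currents hη
    (funext fun a => by rw [leftCurrent_waveFlow, add_zero])
    (funext fun a => by rw [rightCurrent_waveFlow, sub_zero])

theorem waveFlow_add (hη : 0 < η) (s t : ℝ) (p : PrePhase η) :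
    waveFlow hη (s + t) p = waveFlow hη s (waveFlow hη t p) :=
  prePhase_ext_of_currents hη
    (funext fun a => by simp only [leftCurrent_waveFlow, add_assoc])
    (funext fun a => by simp only [rightCurrent_waveFlow, sub_sub])

theorem waveField_waveFlow_snd (hη : 0 < η) (t : ℝ) (p : PrePhase η) :
    ((waveField (waveFlow hη t p)).2 : ℝ → ℝ) =
      wave (deriv (deriv (leftMover p))) (-deriv (-deriv (rightMover p))) t := by
  have hneg : -deriv (-deriv (rightMover p)) = deriv (deriv (rightMover p)) :=
    funext fun a => by rw [Pi.neg_apply, deriv.neg, neg_neg]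
  change deriv (deriv ((waveFlow hη t p).1 : ℝ → ℝ)) = _
  rw [deriv_waveFlow_fst, deriv_wave (isWavePair_movers p).deriv_left_mem.1
    (isWavePair_movers p).deriv_right_mem.1, hneg]

theorem hasFrechetDerivAt_waveFlow (hη : 0 < η) (t : ℝ) (p : PrePhase η) :
    HasFrechetDerivAt (fun s => waveFlow hη s p) (waveField (waveFlow hη t p)) t := by
  intro k ε hε
  have hmovers := isWavePair_movers p
  have hsnd := hmovers.derivs_neg.eventually_abs_slope_sub_le (by linarith) k t hε
  rw [← waveField_waveFlow_snd hη] at hsnd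
  filter_upwards [hmovers.eventually_abs_slope_sub_le hη.le k t hε, hsnd] with h h₁ h₂ a
  exact ⟨h₁ a, h₂ a⟩

end Flow

/-! ### Frames and the presymplectic form -/

section Frame

variable {η : ℝ} {τ n : ℝ × ℝ}

/-- `n` is the Minkowski conjugate `(τ_y, τ_x)` of the non-null vector `τ`; up to a common scale
these are the space-like and the time-like frames. -/
structure IsConjugateFrame (τ n : ℝ × ℝ) : Prop where
  normal_eq : n = (τ.2, τ.1)
  not_null : mink τ τ ≠ 0

theorem IsSpacelikeFrame.isConjugateFrame (h : IsSpacelikeFrame τ n) : IsConjugateFrame τ n := by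
  obtain ⟨hτ, hn, hτn, harea⟩ := h
  have hone : area τ n = 1 := by
    have hsq : area τ n ^ 2 = 1 := by
      simp only [mink, area] at hτ hn hτn ⊢
      linear_combination (τ.1 * n.1 - τ.2 * n.2) * hτn - (n.1 * n.1 - n.2 * n.2) * hτ - hn
    nlinarith
  refine ⟨Prod.ext ?_ ?_, by rw [hτ]; exact one_ne_zero⟩ <;>
    simp only [mink, area] at hτ hτn hone ⊢
  · linear_combination τ.2 * hone - n.1 * hτ + τ.1 * hτn
  · linear_combination τ.1 * hone - n.2 * hτ + τ.2 * hτn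

theorem IsTimelikeFrame.isConjugateFrame (h : IsTimelikeFrame τ n) : IsConjugateFrame τ n := by
  obtain ⟨hτ, hn, hτn, harea⟩ := h
  have hone : area n τ = 1 := by
    have hsq : area n τ ^ 2 = 1 := by
      simp only [mink, area] at hτ hn hτn ⊢
      linear_combination (τ.1 * n.1 - τ.2 * n.2) * hτn - (n.1 * n.1 - n.2 * n.2) * hτ + hn
    nlinarith
  refine ⟨Prod.ext ?_ ?_, by rw [hτ]; norm_num⟩ <;>
    simp only [mink, area] at hτ hτn hone ⊢
  · linear_combination τ.2 * hone + n.1 * hτ - τ.1 * hτn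
  · linear_combination τ.1 * hone + n.2 * hτ - τ.2 * hτn

theorem IsConjugateFrame.area_eq (h : IsConjugateFrame τ n) : area τ n = mink τ τ := by
  rw [h.normal_eq]; rfl

theorem IsConjugateFrame.mink_eq_zero (h : IsConjugateFrame τ n) : mink τ n = 0 := by
  rw [h.normal_eq, mink]; ring

theorem IsConjugateFrame.area_ne_zero (h : IsConjugateFrame τ n) : area τ n ≠ 0 :=
  h.area_eq ▸ h.not_null

theorem IsLightlikeFrame.mink_ne_zero (h : IsLightlikeFrame τ n) : mink τ n ≠ 0 := by
  have hgram : area τ n ^ 2 = mink τ n ^ 2 - mink τ τ * mink n n := by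
    simp only [area, mink]; ring
  rw [h.tangent, zero_mul, sub_zero] at hgram
  exact fun h₀ => pow_ne_zero 2 h.independent (by rw [hgram, h₀, zero_pow two_ne_zero])

theorem area_swap (v w : ℝ × ℝ) : area v w = -area w v := by
  simp only [area]
  ring

theorem area_raisedConormal (v : ℝ × ℝ) :
    area v (raisedConormal τ n) = -mink τ v / area τ n := by
  simp only [raisedConormal, conormal, area, mink]
  ring

theorem bdryDensity_mul_bdryGamma : bdryDensity τ n * bdryGamma τ n = mink τ τ / area τ n := by
  rcases eq_or_ne (area τ n) 0 with h | h
  · simp [bdryDensity, area_swap n, h]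
  rw [bdryDensity, bdryGamma, conormal, area_raisedConormal, area_swap n]
  field_simp

theorem bdryDensity_mul_bdryDrift (h : area τ n ≠ 0) :
    bdryDensity τ n * bdryDrift τ n = -mink τ n / area τ n := by
  have hself (v : ℝ × ℝ) (c : ℝ) : area n (v - c • n) = area n v := by
    simp only [area, Prod.fst_sub, Prod.snd_sub, Prod.smul_fst, Prod.smul_snd, smul_eq_mul]
    ring
  have hdensity : area n τ ≠ 0 := by rwa [area_swap, neg_ne_zero]
  rw [bdryDensity, bdryDrift, conormal, hself, area_raisedConormal, mul_div_cancel₀ _ hdensity]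

theorem preForm_eq (hη : 0 < η) (h : area τ n ≠ 0) (p q : PrePhase η) :
    preForm η hη τ n p q =
      mink τ τ / area τ n * (∫ a, ((p.2 : ℝ → ℝ) a * (q.1 : ℝ → ℝ) a
        - (q.2 : ℝ → ℝ) a * (p.1 : ℝ → ℝ) a))
      - 2 * mink τ n / area τ n * ∫ a, deriv (p.1 : ℝ → ℝ) a * (q.1 : ℝ → ℝ) a := by
  have halpha (p q : PrePhase η) : alphaForm η hη τ n p q =
      mink τ τ / area τ n * (∫ a, (p.2 : ℝ → ℝ) a * (q.1 : ℝ → ℝ) a)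
        - mink τ n / area τ n * ∫ a, deriv (p.1 : ℝ → ℝ) a * (q.1 : ℝ → ℝ) a := by
    change bdryDensity τ n * (∫ a, (bdryGamma τ n * (p.2 : ℝ → ℝ) a
      + bdryDrift τ n * deriv (p.1 : ℝ → ℝ) a) * (q.1 : ℝ → ℝ) a) = _
    simp only [add_mul, mul_assoc]
    rw [integral_add ((integrable_mul hη p.2 q.1).const_mul _)
      ((integrable_deriv_mul hη p.1 q.1).const_mul _), integral_const_mul, integral_const_mul,
      mul_add, ← mul_assoc, ← mul_assoc, bdryDensity_mul_bdryGamma, bdryDensity_mul_bdryDrift h]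
    ring
  have hparts : ∫ a, deriv (q.1 : ℝ → ℝ) a * (p.1 : ℝ → ℝ) a =
      -∫ a, deriv (p.1 : ℝ → ℝ) a * (q.1 : ℝ → ℝ) a := by
    rw [integral_deriv_mul_eq_neg (by linarith) q.1.2 p.1.2]
    simp only [mul_comm]
  rw [preForm, LinearMap.sub_apply, LinearMap.sub_apply, LinearMap.flip_apply, halpha, halpha,
    hparts, integral_sub (integrable_mul hη p.2 q.1) (integrable_mul hη q.2 p.1)]
  ring

theorem IsConjugateFrame.preForm_eq (h : IsConjugateFrame τ n) (hη : 0 < η) (p q : PrePhase η) :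
    preForm η hη τ n p q =
      ∫ a, ((p.2 : ℝ → ℝ) a * (q.1 : ℝ → ℝ) a - (q.2 : ℝ → ℝ) a * (p.1 : ℝ → ℝ) a) := by
  rw [MinkowskiStrip.preForm_eq hη h.area_ne_zero, h.area_eq, div_self h.not_null,
    h.mink_eq_zero, mul_zero, zero_div, zero_mul, one_mul, sub_zero]

theorem IsLightlikeFrame.preForm_eq (h : IsLightlikeFrame τ n) (hη : 0 < η) (p q : PrePhase η) :
    preForm η hη τ n p q =
      -(2 * mink τ n / area τ n) * ∫ a, deriv (p.1 : ℝ → ℝ) a * (q.1 : ℝ → ℝ) a := by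
  rw [MinkowskiStrip.preForm_eq hη h.independent, h.tangent, zero_div, zero_mul, zero_sub, neg_mul]

theorem IsConjugateFrame.ker_preForm (h : IsConjugateFrame τ n) (hη : 0 < η) :
    LinearMap.ker (preForm η hη τ n) = ⊥ := by
  rw [LinearMap.ker_eq_bot']
  intro p hp
  have hzero (q : PrePhase η) : ∫ a, ((p.2 : ℝ → ℝ) a * (q.1 : ℝ → ℝ) a
      - (q.2 : ℝ → ℝ) a * (p.1 : ℝ → ℝ) a) = 0 := by
    rw [← h.preForm_eq hη, hp, LinearMap.zero_apply]
  refine prePhase_ext ?_ ?_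
  · refine eq_zero_of_forall_integral_mul_eq_zero (m := η + 1) p.1.2.1.continuous fun g hg => ?_
    simpa [integral_neg, mul_comm] using hzero (0, ⟨g, hg⟩)
  · refine eq_zero_of_forall_integral_mul_eq_zero (m := η) p.2.2.1.continuous fun g hg => ?_
    simpa using hzero (⟨g, hg⟩, 0)

theorem IsLightlikeFrame.mem_ker_preForm_iff (h : IsLightlikeFrame τ n) (hη : 0 < η)
    {p : PrePhase η} : p ∈ LinearMap.ker (preForm η hη τ n) ↔ p.1 = 0 := by
  have hcoeff : -(2 * mink τ n / area τ n) ≠ 0 :=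
    neg_ne_zero.2 (div_ne_zero (mul_ne_zero two_ne_zero h.mink_ne_zero) h.independent)
  rw [LinearMap.mem_ker]
  constructor
  · intro hp
    have hderiv : deriv (p.1 : ℝ → ℝ) = 0 :=
      eq_zero_of_forall_integral_mul_eq_zero (m := η) (p.1.2.1.continuous_deriv (by simp))
        fun g hg => (mul_eq_zero.1 (by
          rw [← h.preForm_eq hη p (⟨g, hg⟩, 0), hp, LinearMap.zero_apply])).resolve_left hcoeff
    exact Subtype.ext (eq_of_deriv_eq hη p.1.2 (decaySpace η).zero_mem
      (by rw [hderiv]; exact (deriv_const' (0 : ℝ)).symm))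
  · intro hp
    refine LinearMap.ext fun q => ?_
    rw [h.preForm_eq hη, hp, LinearMap.zero_apply]
    simp

end Frame

/-! ### Hamiltonian flow -/

section Hamiltonian

variable {η : ℝ}

/-- The symmetric bilinear form `∫ (p₂ q₂ + p₁' q₁')` of the quadratic Hamiltonian. -/
def energyPairing (p q : PrePhase η) : ℝ :=
  ∫ a, ((p.2 : ℝ → ℝ) a * (q.2 : ℝ → ℝ) a + deriv (p.1 : ℝ → ℝ) a * deriv (q.1 : ℝ → ℝ) a)

theorem integrable_energyDensity (hη : 0 < η) (p q : PrePhase η) :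
    Integrable fun a => (p.2 : ℝ → ℝ) a * (q.2 : ℝ → ℝ) a
      + deriv (p.1 : ℝ → ℝ) a * deriv (q.1 : ℝ → ℝ) a :=
  (integrable_mul_of_mem (by linarith) p.2.2 q.2.2).add
    (integrable_mul_of_mem (by linarith) (deriv_mem_decaySpace p.1.2) (deriv_mem_decaySpace q.1.2))

theorem hamiltonian_eq_energyPairing (p : PrePhase η) :
    hamiltonian p = 1 / 2 * energyPairing p p := by
  simp only [hamiltonian, energyPairing, sq]

theorem energyPairing_comm (p q : PrePhase η) : energyPairing p q = energyPairing q p := by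
  simp only [energyPairing, mul_comm]

theorem energyPairing_add_smul_left (hη : 0 < η) (p w q : PrePhase η) (t : ℝ) :
    energyPairing (p + t • w) q = energyPairing p q + t * energyPairing w q := by
  have hderiv (a : ℝ) : deriv ((p + t • w).1 : ℝ → ℝ) a =
      deriv (p.1 : ℝ → ℝ) a + t * deriv (w.1 : ℝ → ℝ) a :=
    ((differentiable_of_mem p.1 a).hasDerivAt.add
      ((differentiable_of_mem w.1 a).hasDerivAt.const_mul t)).deriv
  rw [energyPairing, energyPairing, energyPairing, ← integral_const_mul,
    ← integral_add (integrable_energyDensity hη p q)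
      ((integrable_energyDensity hη w q).const_mul t)]
  refine integral_congr_ae (Eventually.of_forall fun a => ?_)
  simp only [hderiv, Prod.snd_add, Prod.smul_snd, Submodule.coe_add, Submodule.coe_smul,
    Pi.add_apply, Pi.smul_apply, smul_eq_mul]
  ring

theorem hamiltonian_add_smul (hη : 0 < η) (p w : PrePhase η) (t : ℝ) :
    hamiltonian (p + t • w) = hamiltonian p + t * energyPairing w p + t ^ 2 * hamiltonian w := by
  simp only [hamiltonian_eq_energyPairing]
  rw [energyPairing_add_smul_left hη, energyPairing_comm p, energyPairing_comm w (p + t • w),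
    energyPairing_add_smul_left hη, energyPairing_add_smul_left hη, energyPairing_comm p w]
  ring

namespace IsConjugateFrame

variable {τ n : ℝ × ℝ}

theorem preForm_waveField (h : IsConjugateFrame τ n) (hη : 0 < η) (w p : PrePhase η) :
    preForm η hη τ n w (waveField p) = energyPairing w p := by
  have hp' := deriv_mem_decaySpace p.1.2
  have hw' := deriv_mem_decaySpace w.1.2
  have hmul : Integrable fun a => (w.2 : ℝ → ℝ) a * (p.2 : ℝ → ℝ) a :=
    integrable_mul_of_mem (by linarith) w.2.2 p.2.2
  rw [h.preForm_eq hη]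
  change ∫ a, ((w.2 : ℝ → ℝ) a * (p.2 : ℝ → ℝ) a
    - deriv (deriv (p.1 : ℝ → ℝ)) a * (w.1 : ℝ → ℝ) a) = _
  rw [energyPairing, integral_sub hmul
      (integrable_mul_of_mem (by linarith) (deriv_mem_decaySpace hp') w.1.2),
    integral_deriv_mul_eq_neg (by linarith) hp' w.1.2, sub_neg_eq_add,
    integral_add hmul (integrable_mul_of_mem (by linarith) hw' hp')]
  simp only [mul_comm]

theorem isHamiltonianVectorField_waveField (h : IsConjugateFrame τ n) (hη : 0 < η) :
    IsHamiltonianVectorField (preForm η hη τ n) hamiltonian waveField := by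
  intro p w
  rw [h.preForm_waveField hη]
  simp only [hamiltonian_add_smul hη]
  simpa using (((hasDerivAt_id' (0 : ℝ)).mul_const (energyPairing w p)).const_add
    (hamiltonian p)).fun_add (((hasDerivAt_id' (0 : ℝ)).fun_pow 2).mul_const (hamiltonian w))

theorem isHamiltonianFlow_waveFlow (h : IsConjugateFrame τ n) (hη : 0 < η) :
    IsHamiltonianFlow (preForm η hη τ n) hamiltonian (waveFlow hη) :=
  ⟨waveField, h.isHamiltonianVectorField_waveField hη, waveFlow_zero hη, waveFlow_add hη,
    hasFrechetDerivAt_waveFlow hη⟩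

theorem preForm_waveFlow (h : IsConjugateFrame τ n) (hη : 0 < η) (t : ℝ) (p q : PrePhase η) :
    preForm η hη τ n (waveFlow hη t p) (waveFlow hη t q) = preForm η hη τ n p q := by
  have hchiral (t : ℝ) : preForm η hη τ n (waveFlow hη t p) (waveFlow hη t q) =
      (∫ a, wronskian (leftMover p) (leftMover q) a)
        - ∫ a, wronskian (rightMover p) (rightMover q) a := by
    rw [h.preForm_eq hη]
    exact (isWavePair_movers p).integral_wave_mul_wave_sub hη (isWavePair_movers q) t
  rw [hchiral t, ← hchiral 0, waveFlow_zero, waveFlow_zero]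

end IsConjugateFrame

end Hamiltonian

/-! ### Lagrangian relations -/

section Lagrangian

theorem isLagrangian_of_left_right_total {V W : Type*} [AddCommGroup W] [Module ℝ W]
    {B : V → V → ℝ} {B' : W →ₗ[ℝ] W →ₗ[ℝ] ℝ} (hB' : Function.Injective B') {L : Set (V × W)}
    (hleft : ∀ x, ∃ y, (x, y) ∈ L) (hright : ∀ y, ∃ x, (x, y) ∈ L)
    (hform : ∀ z ∈ L, ∀ w ∈ L, B' z.2 w.2 = B z.1 w.1) :
    IsLagrangian (fun z w : V × W => B' z.2 w.2 - B z.1 w.1) L := by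
  refine Set.Subset.antisymm (fun z hz w hw => sub_eq_zero.2 (hform z hz w hw)) fun z hz => ?_
  obtain ⟨y, hy⟩ := hleft z.1
  suffices hzy : z.2 = y by rwa [← hzy] at hy
  refine hB' (LinearMap.ext fun v => ?_)
  obtain ⟨x, hx⟩ := hright v
  exact (sub_eq_zero.1 (hz _ hx)).trans (hform _ hy _ hx).symm

variable {η : ℝ} (hη : 0 < η) (τ n : ℝ × ℝ)

theorem toPhase_eq_iff {p q : PrePhase η} : toPhase η hη τ n p = toPhase η hη τ n q ↔
    p - q ∈ LinearMap.ker (preForm η hη τ n) :=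
  Submodule.Quotient.eq _

theorem phaseForm_injective : Function.Injective (phaseForm η hη τ n) := by
  rw [← LinearMap.ker_eq_bot, LinearMap.ker_eq_bot']
  intro x hx
  obtain ⟨p, rfl⟩ := Submodule.mkQ_surjective _ x
  refine (Submodule.Quotient.mk_eq_zero _).2 (LinearMap.mem_ker.2 (LinearMap.ext fun q => ?_))
  exact congrArg (fun f => f (toPhase η hη τ n q)) hx

theorem isLagrangian_diagonal : IsLagrangian (stripForm η hη τ n) {z | z.1 = z.2} :=
  isLagrangian_of_left_right_total (B := fun x y => phaseForm η hη τ n x y)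
    (phaseForm_injective hη τ n) (fun x => ⟨x, rfl⟩) (fun y => ⟨y, rfl⟩)
    fun z (hz : z.1 = z.2) w (hw : w.1 = w.2) => by rw [hz, hw]

theorem isLagrangian_graph_of_symplectic {U : PrePhase η → PrePhase η}
    (hU : Function.Surjective U)
    (hform : ∀ p q, preForm η hη τ n (U p) (U q) = preForm η hη τ n p q) :
    IsLagrangian (stripForm η hη τ n)
      (Set.range fun p => (toPhase η hη τ n p, toPhase η hη τ n (U p))) := by
  refine isLagrangian_of_left_right_total (B := fun x y => phaseForm η hη τ n x y)
    (phaseForm_injective hη τ n) (fun x => ?_) (fun y => ?_) ?_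
  · obtain ⟨p, rfl⟩ := Submodule.mkQ_surjective _ x
    exact ⟨_, p, rfl⟩
  · obtain ⟨q, rfl⟩ := Submodule.mkQ_surjective _ y
    obtain ⟨p, rfl⟩ := hU q
    exact ⟨_, p, rfl⟩
  · rintro _ ⟨p, rfl⟩ _ ⟨q, rfl⟩
    simp only [phaseForm_toPhase, hform]

end Lagrangian

/-! ### Strips -/

section Strip

variable {τ n : ℝ × ℝ} {s₀ s₁ : ℝ}

/-- The covector `n*` as a continuous linear form: the coordinate along `n` in the frame
`(τ, n)`. Accordingly `conormalCLM n τ` is the coordinate along `τ`. -/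
def conormalCLM (τ n : ℝ × ℝ) : ℝ × ℝ →L[ℝ] ℝ :=
  (area τ n)⁻¹ • (τ.1 • ContinuousLinearMap.snd ℝ ℝ ℝ - τ.2 • ContinuousLinearMap.fst ℝ ℝ ℝ)

theorem conormalCLM_apply (τ n v : ℝ × ℝ) : conormalCLM τ n v = conormal τ n v := by
  simp only [conormalCLM, smul_apply, sub_apply, ContinuousLinearMap.coe_fst',
    ContinuousLinearMap.coe_snd', smul_eq_mul, conormal, area, div_eq_inv_mul]

theorem conormalCLM_frame (h : area τ n ≠ 0) (a s : ℝ) :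
    conormalCLM τ n (a • τ + s • n) = s := by
  rw [conormalCLM_apply, conormal, div_eq_iff h]
  simp only [area, Prod.fst_add, Prod.snd_add, Prod.smul_fst, Prod.smul_snd, smul_eq_mul]
  ring

theorem conormalCLM_sub_smul_frame (h : area τ n ≠ 0) (c a s : ℝ) :
    conormalCLM (n - c • τ) τ (a • τ + s • n) = a + c * s := by
  have hshear : area (n - c • τ) τ = -area τ n := by
    simp only [area, Prod.fst_sub, Prod.snd_sub, Prod.smul_fst, Prod.smul_snd, smul_eq_mul]
    ring
  rw [show a • τ + s • n = s • (n - c • τ) + (a + c * s) • τ by module,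
    conormalCLM_frame (by rwa [hshear, neg_ne_zero])]

theorem conormalCLM_sq_eq_of_null (h : mink τ τ = 0) :
    conormalCLM τ n (1, 0) ^ 2 = conormalCLM τ n (0, 1) ^ 2 := by
  rw [mink] at h
  simp only [conormalCLM_apply, conormal, area]
  linear_combination -((τ.1 * n.2 - τ.2 * n.1)⁻¹) ^ 2 * h

theorem eq_conormalCLM_frame (h : area τ n ≠ 0) (p : ℝ × ℝ) :
    p = conormalCLM n τ p • τ + conormalCLM τ n p • n := by
  have hinv := mul_inv_cancel₀ h
  simp only [conormalCLM_apply, conormal, area_swap n τ, div_eq_mul_inv, inv_neg]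
  generalize (area τ n)⁻¹ = c at hinv ⊢
  refine Prod.ext ?_ ?_ <;>
    simp only [area, Prod.fst_add, Prod.snd_add, Prod.smul_fst, Prod.smul_snd,
      smul_eq_mul] at hinv ⊢
  · linear_combination -p.1 * hinv
  · linear_combination -p.2 * hinv

theorem mem_strip (τ n : ℝ × ℝ) {s : ℝ} (hs : s ∈ Icc s₀ s₁) (a : ℝ) :
    a • τ + s • n ∈ strip τ n s₀ s₁ :=
  ⟨a, s, hs, rfl⟩

theorem strip_eq_preimage (h : area τ n ≠ 0) (s₀ s₁ : ℝ) :
    strip τ n s₀ s₁ = conormalCLM τ n ⁻¹' Icc s₀ s₁ := by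
  ext p
  constructor
  · rintro ⟨a, s, hs, rfl⟩
    rwa [mem_preimage, conormalCLM_frame h]
  · exact fun hp => ⟨_, _, hp, eq_conormalCLM_frame h p⟩

theorem convex_strip (h : area τ n ≠ 0) (s₀ s₁ : ℝ) : Convex ℝ (strip τ n s₀ s₁) := by
  rw [strip_eq_preimage h]
  exact (convex_Icc s₀ s₁).is_linear_preimage (conormalCLM τ n).isLinear

theorem nonempty_interior_strip (h : area τ n ≠ 0) (hs : s₀ < s₁) :
    (interior (strip τ n s₀ s₁)).Nonempty := by
  obtain ⟨s, hs⟩ := exists_between hs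
  rw [strip_eq_preimage h]
  refine ⟨(0 : ℝ) • τ + s • n, interior_maximal (preimage_mono Ioo_subset_Icc_self)
    (isOpen_Ioo.preimage (conormalCLM τ n).continuous) ?_⟩
  rwa [mem_preimage, conormalCLM_frame h]

theorem uniqueDiffOn_strip (h : area τ n ≠ 0) (hs : s₀ < s₁) :
    UniqueDiffOn ℝ (strip τ n s₀ s₁) :=
  uniqueDiffOn_convex (convex_strip h s₀ s₁) (nonempty_interior_strip h hs)

theorem strip_subset_closure_interior (h : area τ n ≠ 0) (hs : s₀ < s₁) :
    strip τ n s₀ s₁ ⊆ closure (interior (strip τ n s₀ s₁)) := by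
  rw [(convex_strip h s₀ s₁).closure_interior_eq_closure_of_nonempty_interior
    (nonempty_interior_strip h hs)]
  exact subset_closure

theorem exists_one_add_sq_add_sq_le (τ n : ℝ × ℝ) (T : ℝ) :
    ∃ K : ℝ, 0 < K ∧ ∀ a s : ℝ, |s| ≤ T →
      1 + (a • τ + s • n).1 ^ 2 + (a • τ + s • n).2 ^ 2 ≤ K * (1 + a ^ 2) := by
  refine ⟨1 + 2 * (τ.1 ^ 2 + τ.2 ^ 2) + 2 * T ^ 2 * (n.1 ^ 2 + n.2 ^ 2), by positivity,
    fun a s hs => ?_⟩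
  have hsq : s ^ 2 ≤ T ^ 2 := sq_le_sq.2 (hs.trans (le_abs_self T))
  have hcoord (x y : ℝ) : (a * x + s * y) ^ 2 ≤ 2 * a ^ 2 * x ^ 2 + 2 * T ^ 2 * y ^ 2 := by
    nlinarith [sq_nonneg (a * x - s * y), mul_le_mul_of_nonneg_right hsq (sq_nonneg y)]
  have hrest : 0 ≤ a ^ 2 + 2 * (τ.1 ^ 2 + τ.2 ^ 2)
      + 2 * T ^ 2 * (n.1 ^ 2 + n.2 ^ 2) * a ^ 2 := by positivity
  simp only [Prod.fst_add, Prod.snd_add, Prod.smul_fst, Prod.smul_snd, smul_eq_mul]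
  linarith [hcoord τ.1 n.1, hcoord τ.2 n.2]

end Strip

/-! ### Superpositions of plane waves -/

section Superposition

variable {E : Type*} [NormedAddCommGroup E] [NormedSpace ℝ E] {D : Set E} {m : ℝ} {F G : ℝ → ℝ}

/-- The superposition of the plane waves with profiles `F`, `G` and phases `ℓ₁`, `ℓ₂`. -/
def superposition (F G : ℝ → ℝ) (ℓ₁ ℓ₂ : E →L[ℝ] ℝ) (p : E) : ℝ :=
  F (ℓ₁ p) + G (ℓ₂ p)

theorem contDiff_superposition (hF : ContDiff ℝ ∞ F) (hG : ContDiff ℝ ∞ G) (ℓ₁ ℓ₂ : E →L[ℝ] ℝ) :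
    ContDiff ℝ ∞ (superposition F G ℓ₁ ℓ₂) :=
  (hF.comp ℓ₁.contDiff).add (hG.comp ℓ₂.contDiff)

theorem fderivWithin_superposition (hD : UniqueDiffOn ℝ D) (hF : Differentiable ℝ F)
    (hG : Differentiable ℝ G) (ℓ₁ ℓ₂ : E →L[ℝ] ℝ) {p : E} (hp : p ∈ D) (v : E) :
    fderivWithin ℝ (superposition F G ℓ₁ ℓ₂) D p v =
      deriv F (ℓ₁ p) * ℓ₁ v + deriv G (ℓ₂ p) * ℓ₂ v := by
  have hsum := ((hF (ℓ₁ p)).hasDerivAt.comp_hasFDerivAt p ℓ₁.hasFDerivAt).add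
    ((hG (ℓ₂ p)).hasDerivAt.comp_hasFDerivAt p ℓ₂.hasFDerivAt)
  change fderivWithin ℝ (F ∘ ℓ₁ + G ∘ ℓ₂) D p v = _
  rw [hsum.hasFDerivWithinAt.fderivWithin (hD p hp)]
  simp only [add_apply, smul_apply, smul_eq_mul]

theorem iteratedFDerivWithin_superposition (hD : UniqueDiffOn ℝ D) (hF : ContDiff ℝ ∞ F)
    (hG : ContDiff ℝ ∞ G) (ℓ₁ ℓ₂ : E →L[ℝ] ℝ) (k : ℕ) {p : E} (hp : p ∈ D) :
    iteratedFDerivWithin ℝ k (superposition F G ℓ₁ ℓ₂) D p =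
      (iteratedFDeriv ℝ k F (ℓ₁ p)).compContinuousLinearMap (fun _ => ℓ₁)
        + (iteratedFDeriv ℝ k G (ℓ₂ p)).compContinuousLinearMap (fun _ => ℓ₂) := by
  have hk : (k : WithTop ℕ∞) ≤ ∞ := by exact_mod_cast le_top
  rw [iteratedFDerivWithin_eq_iteratedFDeriv hD
    ((contDiff_superposition hF hG ℓ₁ ℓ₂).of_le hk).contDiffAt hp]
  change iteratedFDeriv ℝ k (F ∘ ℓ₁ + G ∘ ℓ₂) p = _
  rw [iteratedFDeriv_add_apply ((hF.comp ℓ₁.contDiff).of_le hk).contDiffAt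
      ((hG.comp ℓ₂.contDiff).of_le hk).contDiffAt,
    ℓ₁.iteratedFDeriv_comp_right hF p hk, ℓ₂.iteratedFDeriv_comp_right hG p hk]

theorem norm_iteratedFDeriv_compContinuousLinearMap_le (F : ℝ → ℝ) (ℓ : E →L[ℝ] ℝ) (k : ℕ)
    (x : ℝ) : ‖(iteratedFDeriv ℝ k F x).compContinuousLinearMap (fun _ => ℓ)‖ ≤
      ‖ℓ‖ ^ k * |iteratedDeriv k F x| := by
  refine (ContinuousMultilinearMap.norm_compContinuousLinearMap_le _ _).trans_eq ?_
  rw [norm_iteratedFDeriv_eq_norm_iteratedDeriv, Real.norm_eq_abs, mul_comm, Finset.prod_const,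
    Finset.card_univ, Fintype.card_fin]

theorem IsWavePair.exists_norm_iteratedFDerivWithin_superposition_le (hm : 0 ≤ m)
    (h : IsWavePair m F G) (hD : UniqueDiffOn ℝ D) (ℓ₁ ℓ₂ : E →L[ℝ] ℝ) {T : ℝ} (hT : 0 ≤ T)
    (k : ℕ) : ∃ C : ℝ, ∀ p ∈ D, ∀ a : ℝ, |ℓ₁ p - a| ≤ T → |ℓ₂ p - a| ≤ T →
      ‖iteratedFDerivWithin ℝ k (superposition F G ℓ₁ ℓ₂) D p‖ ≤
        C * (1 + a ^ 2) ^ (-(m + k) / 2) := by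
  rcases k with _ | k
  · obtain ⟨C, hC⟩ := h.exists_bound_add hm hT
    exact ⟨C, fun p _ a h₁ h₂ => by simpa [superposition] using hC a _ _ h₁ h₂⟩
  · have hplane {f : ℝ → ℝ} (hf : deriv f ∈ decaySpace (m + 1)) (ℓ : E →L[ℝ] ℝ) :
        ∃ C : ℝ, ∀ p a, |ℓ p - a| ≤ T →
          ‖(iteratedFDeriv ℝ (k + 1) f (ℓ p)).compContinuousLinearMap (fun _ => ℓ)‖ ≤
            C * (1 + a ^ 2) ^ (-(m + 1 + k) / 2) := by
      obtain ⟨C, -, hC⟩ := HasDecay.exists_bound_near (by positivity) (hf.2 k) T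
      refine ⟨‖ℓ‖ ^ (k + 1) * C, fun p a ha => ?_⟩
      refine (norm_iteratedFDeriv_compContinuousLinearMap_le f ℓ (k + 1) (ℓ p)).trans ?_
      rw [iteratedDeriv_succ', mul_assoc]
      exact mul_le_mul_of_nonneg_left (hC a _ ha) (by positivity)
    obtain ⟨C₁, hC₁⟩ := hplane h.deriv_left_mem ℓ₁
    obtain ⟨C₂, hC₂⟩ := hplane h.deriv_right_mem ℓ₂
    refine ⟨C₁ + C₂, fun p hp a h₁ h₂ => ?_⟩
    rw [iteratedFDerivWithin_superposition hD h.contDiff_left h.contDiff_right _ _ _ hp, add_mul,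
      Nat.cast_succ, ← add_assoc, add_right_comm]
    exact (norm_add_le _ _).trans (add_le_add (hC₁ p a h₁) (hC₂ p a h₂))

theorem IsWavePair.isField_superposition {D : Set (ℝ × ℝ)} (hm : 0 ≤ m) (h : IsWavePair m F G)
    (hD : UniqueDiffOn ℝ D) {ℓ₁ ℓ₂ : ℝ × ℝ →L[ℝ] ℝ} {K T : ℝ} (hK : 0 < K) (hT : 0 ≤ T)
    (hnear : ∀ p ∈ D, ∃ a, |ℓ₁ p - a| ≤ T ∧ |ℓ₂ p - a| ≤ T ∧
      1 + p.1 ^ 2 + p.2 ^ 2 ≤ K * (1 + a ^ 2)) :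
    IsField m D (superposition F G ℓ₁ ℓ₂) := by
  refine ⟨(contDiff_superposition h.contDiff_left h.contDiff_right ℓ₁ ℓ₂).contDiffOn,
    fun k => ?_⟩
  obtain ⟨C, hC⟩ := h.exists_norm_iteratedFDerivWithin_superposition_le hm hD ℓ₁ ℓ₂ hT k
  refine ⟨|C| * K ^ ((m + k) / 2), fun p hp => ?_⟩
  obtain ⟨a, h₁, h₂, hpa⟩ := hnear p hp
  calc ‖iteratedFDerivWithin ℝ k (superposition F G ℓ₁ ℓ₂) D p‖
      ≤ C * (1 + a ^ 2) ^ (-(m + k) / 2) := hC p hp a h₁ h₂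
    _ ≤ |C| * (K ^ ((m + k) / 2) * (1 + p.1 ^ 2 + p.2 ^ 2) ^ (-(m + k) / 2)) :=
        mul_le_mul (le_abs_self C)
          (rpow_neg_le_of_le_mul (by positivity) hK (by positivity) hpa)
          (by positivity) (abs_nonneg C)
    _ = |C| * K ^ ((m + k) / 2) * (1 + p.1 ^ 2 + p.2 ^ 2) ^ (-(m + k) / 2) :=
        (mul_assoc _ _ _).symm

theorem solvesWaveEquation_superposition {D : Set (ℝ × ℝ)} (hD : UniqueDiffOn ℝ D)
    (hF : ContDiff ℝ ∞ F) (hG : ContDiff ℝ ∞ G) {ℓ₁ ℓ₂ : ℝ × ℝ →L[ℝ] ℝ}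
    (h₁ : ℓ₁ (1, 0) ^ 2 = ℓ₁ (0, 1) ^ 2) (h₂ : ℓ₂ (1, 0) ^ 2 = ℓ₂ (0, 1) ^ 2) :
    SolvesWaveEquation D (superposition F G ℓ₁ ℓ₂) := by
  intro p hp
  rw [iteratedFDerivWithin_superposition hD hF hG ℓ₁ ℓ₂ 2 hp]
  simp only [add_apply, ContinuousMultilinearMap.compContinuousLinearMap_apply,
    iteratedFDeriv_apply_eq_iteratedDeriv_mul_prod, Finset.prod_const, Finset.card_univ,
    Fintype.card_fin, h₁, h₂, sub_self]

end Superposition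

section CharacteristicField

variable {η : ℝ} {τ n : ℝ × ℝ} {s₀ s₁ c d : ℝ} {F G : ℝ → ℝ}

/-- The field `a τ + s n ↦ F (a + c s) + G (a + d s)`, constant in its two summands along
`n - c τ` and `n - d τ`. -/
def characteristicField (τ n : ℝ × ℝ) (c d : ℝ) (F G : ℝ → ℝ) : ℝ × ℝ → ℝ :=
  superposition F G (conormalCLM (n - c • τ) τ) (conormalCLM (n - d • τ) τ)

theorem IsWavePair.isField_characteristicField (hη : 0 ≤ η) (hFG : IsWavePair η F G)
    (h : area τ n ≠ 0) (hs : s₀ < s₁) (c d : ℝ) :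
    IsField η (strip τ n s₀ s₁) (characteristicField τ n c d F G) := by
  obtain ⟨K, hK, hbound⟩ := exists_one_add_sq_add_sq_le τ n (max |s₀| |s₁|)
  refine hFG.isField_superposition hη (uniqueDiffOn_strip h hs) hK
    (T := max |c| |d| * max |s₀| |s₁|) (by positivity) ?_
  rintro _ ⟨a, s, hs, rfl⟩
  have habs : |s| ≤ max |s₀| |s₁| := abs_le_max_abs_abs hs.1 hs.2
  refine ⟨a, ?_, ?_, hbound a s habs⟩ <;>
    rw [conormalCLM_sub_smul_frame h, add_sub_cancel_left, abs_mul]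
  · exact mul_le_mul (le_max_left _ _) habs (abs_nonneg s) (by positivity)
  · exact mul_le_mul (le_max_right _ _) habs (abs_nonneg s) (by positivity)

theorem IsWavePair.solvesWaveEquation_characteristicField (hFG : IsWavePair η F G)
    (h : area τ n ≠ 0) (hs : s₀ < s₁) (hc : mink (n - c • τ) (n - c • τ) = 0)
    (hd : mink (n - d • τ) (n - d • τ) = 0) :
    SolvesWaveEquation (strip τ n s₀ s₁) (characteristicField τ n c d F G) :=
  solvesWaveEquation_superposition (uniqueDiffOn_strip h hs) hFG.contDiff_left hFG.contDiff_right
    (conormalCLM_sq_eq_of_null hc) (conormalCLM_sq_eq_of_null hd)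

theorem isBoundaryValue_characteristicField (h : area τ n ≠ 0) (hs : s₀ < s₁) {s : ℝ}
    (hmem : s ∈ Icc s₀ s₁) (hF : Differentiable ℝ F) (hG : Differentiable ℝ G) {p : PrePhase η}
    (hp₁ : ∀ a, (p.1 : ℝ → ℝ) a = F (a + c * s) + G (a + d * s))
    (hp₂ : ∀ a, (p.2 : ℝ → ℝ) a = c * deriv F (a + c * s) + d * deriv G (a + d * s)) :
    IsBoundaryValue (strip τ n s₀ s₁) τ n s (characteristicField τ n c d F G) p := by
  have hnormal (b : ℝ) : conormalCLM (n - b • τ) τ n = b := by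
    simpa using conormalCLM_sub_smul_frame h b 0 1
  intro a
  rw [characteristicField, fderivWithin_superposition (uniqueDiffOn_strip h hs) hF hG _ _
    (mem_strip τ n hmem a), superposition, hnormal, hnormal, conormalCLM_sub_smul_frame h,
    conormalCLM_sub_smul_frame h]
  exact ⟨hp₁ a, by rw [hp₂]; ring⟩

end CharacteristicField

/-! ### Propagation along characteristics -/

section Propagation

/-- The symmetric product of `d` and `e` is proportional to `∂_x² - ∂_y²`, so that a solution of
the wave equation satisfies `∂_d ∂_e φ = 0`. -/
structure IsNullPair (d e : ℝ × ℝ) : Prop where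
  diag : d.1 * e.1 + d.2 * e.2 = 0
  cross : d.1 * e.2 + d.2 * e.1 = 0

theorem IsNullPair.fderivWithin_fderivWithin_eq_zero {d e : ℝ × ℝ} (hde : IsNullPair d e)
    {D : Set (ℝ × ℝ)} (hD : UniqueDiffOn ℝ D) {φ : ℝ × ℝ → ℝ} (hw : SolvesWaveEquation D φ)
    {q : ℝ × ℝ} (hq : q ∈ D) (hsymm : IsSymmSndFDerivWithinAt ℝ φ D q) :
    fderivWithin ℝ (fderivWithin ℝ φ D) D q d e = 0 := by
  have hmixed := hsymm.eq (1, 0) (0, 1)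
  have hwave := hw q hq
  rw [iteratedFDerivWithin_two_apply φ hD hq, iteratedFDerivWithin_two_apply φ hD hq] at hwave
  have hbasis (v : ℝ × ℝ) : v = v.1 • ((1, 0) : ℝ × ℝ) + v.2 • ((0, 1) : ℝ × ℝ) :=
    Prod.ext (by simp) (by simp)
  rw [hbasis d, hbasis e]
  simp only [map_add, map_smul, add_apply, smul_apply, smul_eq_mul]
  linear_combination fderivWithin ℝ (fderivWithin ℝ φ D) D q (1, 0) (1, 0) * hde.diag
    + fderivWithin ℝ (fderivWithin ℝ φ D) D q (1, 0) (0, 1) * hde.cross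
    - d.2 * e.1 * hmixed - d.2 * e.2 * hwave

theorem fderivWithin_add_eq_of_forall_eq_zero {E F : Type*} [NormedAddCommGroup E]
    [NormedSpace ℝ E] [NormedAddCommGroup F] [NormedSpace ℝ F] {D : Set E} (hconv : Convex ℝ D)
    {φ : E → F} (hφ : DifferentiableOn ℝ (fderivWithin ℝ φ D) D) {d e : E}
    (h : ∀ q ∈ D, fderivWithin ℝ (fderivWithin ℝ φ D) D q d e = 0) {q : E} (hq : q ∈ D)
    (hq' : q + d ∈ D) : fderivWithin ℝ φ D (q + d) e = fderivWithin ℝ φ D q e := by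
  have hmaps : MapsTo (fun t : ℝ => q + t • d) (Icc 0 1) D := fun t ht =>
    hconv.add_smul_mem hq hq' ht
  have hder (t : ℝ) (ht : t ∈ Icc (0 : ℝ) 1) :
      HasDerivWithinAt (fun t : ℝ => fderivWithin ℝ φ D (q + t • d) e) 0 (Icc 0 1) t := by
    have hline : HasDerivWithinAt (fun t : ℝ => q + t • d) d (Icc 0 1) t := by
      simpa using (((hasDerivAt_id' t).smul_const d).const_add q).hasDerivWithinAt
    refine (((hφ _ (hmaps ht)).hasFDerivWithinAt.clm_apply
      (hasFDerivWithinAt_const e _ _)).comp_hasDerivWithinAt t hline hmaps).congr_deriv ?_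
    simp [h _ (hmaps ht)]
  have hmean := (convex_Icc (0 : ℝ) 1).norm_image_sub_le_of_norm_hasDerivWithin_le (C := 0) hder
    (fun _ _ => norm_zero.le) (left_mem_Icc.2 zero_le_one) (right_mem_Icc.2 zero_le_one)
  simp only [one_smul, zero_smul, add_zero, zero_mul] at hmean
  exact sub_eq_zero.1 (norm_le_zero_iff.1 hmean)

variable {η : ℝ} {τ n : ℝ × ℝ} {s₀ s₁ s : ℝ} {φ : ℝ × ℝ → ℝ}

theorem fderivWithin_strip_eq_of_isNullPair (h : area τ n ≠ 0) (hs : s₀ < s₁)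
    (hφ : ContDiffOn ℝ ∞ φ (strip τ n s₀ s₁)) (hw : SolvesWaveEquation (strip τ n s₀ s₁) φ)
    {c : ℝ} {e : ℝ × ℝ} (hce : IsNullPair (n - c • τ) e) (a : ℝ) :
    fderivWithin ℝ φ (strip τ n s₀ s₁) (a • τ + s₁ • n) e =
      fderivWithin ℝ φ (strip τ n s₀ s₁) ((a + c * (s₁ - s₀)) • τ + s₀ • n) e := by
  have hD := uniqueDiffOn_strip h hs
  have hsymm (q : ℝ × ℝ) (hq : q ∈ strip τ n s₀ s₁) :
      IsSymmSndFDerivWithinAt ℝ φ (strip τ n s₀ s₁) q :=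
    (hφ q hq).isSymmSndFDerivWithinAt
      (by rw [minSmoothness_of_isRCLikeNormedField]; exact WithTop.coe_le_coe.2 le_top)
      hD (strip_subset_closure_interior h hs hq) hq
  have hend : a • τ + s₁ • n =
      ((a + c * (s₁ - s₀)) • τ + s₀ • n) + (s₁ - s₀) • (n - c • τ) := by module
  rw [hend]
  refine fderivWithin_add_eq_of_forall_eq_zero (convex_strip h s₀ s₁)
    (((contDiffOn_infty_iff_fderivWithin hD).1 hφ).2.differentiableOn (by simp)) (fun q hq => ?_)
    (mem_strip τ n (left_mem_Icc.2 hs.le) _) (hend ▸ mem_strip τ n (right_mem_Icc.2 hs.le) a)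
  rw [map_smul, smul_apply, hce.fderivWithin_fderivWithin_eq_zero hD hw hq (hsymm q hq), smul_zero]

namespace IsBoundaryValue

variable {p : PrePhase η}

theorem deriv_fst (hp : IsBoundaryValue (strip τ n s₀ s₁) τ n s φ p) (hs : s ∈ Icc s₀ s₁)
    (hφ : DifferentiableOn ℝ φ (strip τ n s₀ s₁)) (a : ℝ) :
    deriv (p.1 : ℝ → ℝ) a = fderivWithin ℝ φ (strip τ n s₀ s₁) (a • τ + s • n) τ := by
  have hline : HasDerivAt (fun a : ℝ => a • τ + s • n) τ a := by
    simpa using ((hasDerivAt_id' a).smul_const τ).add_const (s • n)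
  have hcomp := (hφ _ (mem_strip τ n hs a)).hasFDerivWithinAt.comp_hasDerivWithinAt a
    (hline.hasDerivWithinAt (s := univ)) fun b _ => mem_strip τ n hs b
  rw [show (p.1 : ℝ → ℝ) = φ ∘ fun a : ℝ => a • τ + s • n from funext fun a => (hp a).1]
  exact (hasDerivWithinAt_univ.1 hcomp).deriv

theorem leftCurrent_eq (hp : IsBoundaryValue (strip τ n s₀ s₁) τ n s φ p) (hs : s ∈ Icc s₀ s₁)
    (hφ : DifferentiableOn ℝ φ (strip τ n s₀ s₁)) (a : ℝ) :
    leftCurrent p a = fderivWithin ℝ φ (strip τ n s₀ s₁) (a • τ + s • n) (n + τ) := by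
  rw [leftCurrent, Pi.add_apply, (hp a).2, hp.deriv_fst hs hφ, map_add]

theorem rightCurrent_eq (hp : IsBoundaryValue (strip τ n s₀ s₁) τ n s φ p) (hs : s ∈ Icc s₀ s₁)
    (hφ : DifferentiableOn ℝ φ (strip τ n s₀ s₁)) (a : ℝ) :
    rightCurrent p a = fderivWithin ℝ φ (strip τ n s₀ s₁) (a • τ + s • n) (n - τ) := by
  rw [rightCurrent, Pi.sub_apply, (hp a).2, hp.deriv_fst hs hφ, map_sub]

end IsBoundaryValue

end Propagation

/-! ### Evolution relations -/

namespace IsConjugateFrame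

variable {η : ℝ} {τ n : ℝ × ℝ} {s₀ s₁ : ℝ}

theorem isNullPair_sub_add (h : IsConjugateFrame τ n) : IsNullPair (n - (1 : ℝ) • τ) (n + τ) := by
  rw [h.normal_eq]
  constructor <;>
    simp only [Prod.fst_sub, Prod.snd_sub, Prod.fst_add, Prod.snd_add, one_smul] <;> ring

theorem isNullPair_add_sub (h : IsConjugateFrame τ n) :
    IsNullPair (n - (-1 : ℝ) • τ) (n - τ) := by
  rw [h.normal_eq]
  constructor <;>
    simp only [Prod.fst_sub, Prod.snd_sub, Prod.smul_fst, Prod.smul_snd, smul_eq_mul] <;> ring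

theorem mink_sub_smul_self (h : IsConjugateFrame τ n) (c : ℝ) :
    mink (n - c • τ) (n - c • τ) = (c ^ 2 - 1) * mink τ τ := by
  rw [h.normal_eq]
  simp only [mink, Prod.fst_sub, Prod.snd_sub, Prod.smul_fst, Prod.smul_snd, smul_eq_mul]
  ring

theorem eq_waveFlow (h : IsConjugateFrame τ n) (hη : 0 < η) (hs : s₀ < s₁) {φ : ℝ × ℝ → ℝ}
    (hφ : ContDiffOn ℝ ∞ φ (strip τ n s₀ s₁)) (hw : SolvesWaveEquation (strip τ n s₀ s₁) φ)
    {p₀ p₁ : PrePhase η} (h₀ : IsBoundaryValue (strip τ n s₀ s₁) τ n s₀ φ p₀)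
    (h₁ : IsBoundaryValue (strip τ n s₀ s₁) τ n s₁ φ p₁) :
    p₁ = waveFlow hη (s₁ - s₀) p₀ := by
  have hmem₀ := left_mem_Icc.2 hs.le
  have hmem₁ := right_mem_Icc.2 hs.le
  have hdiff := hφ.differentiableOn (by simp)
  refine prePhase_ext_of_currents hη (funext fun a => ?_) (funext fun a => ?_)
  · rw [leftCurrent_waveFlow, h₁.leftCurrent_eq hmem₁ hdiff, h₀.leftCurrent_eq hmem₀ hdiff,
      fderivWithin_strip_eq_of_isNullPair h.area_ne_zero hs hφ hw h.isNullPair_sub_add, one_mul]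
  · rw [rightCurrent_waveFlow, h₁.rightCurrent_eq hmem₁ hdiff, h₀.rightCurrent_eq hmem₀ hdiff,
      fderivWithin_strip_eq_of_isNullPair h.area_ne_zero hs hφ hw h.isNullPair_add_sub,
      neg_one_mul, ← sub_eq_add_neg]

theorem isBoundaryValue_waveFlow (h : IsConjugateFrame τ n) (hη : 0 < η) (hs : s₀ < s₁)
    (p : PrePhase η) {s : ℝ} (hmem : s ∈ Icc s₀ s₁) :
    IsBoundaryValue (strip τ n s₀ s₁) τ n s
      (characteristicField τ n 1 (-1) (leftMover p) (rightMover p)) (waveFlow hη s p) := by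
  have hmovers := isWavePair_movers p
  refine isBoundaryValue_characteristicField h.area_ne_zero hs hmem
    (hmovers.contDiff_left.differentiable (by simp))
    (hmovers.contDiff_right.differentiable (by simp)) (fun a => ?_) (fun a => ?_)
  · rw [waveFlow_fst, wave, one_mul, neg_one_mul, ← sub_eq_add_neg]
  · rw [waveFlow_snd, wave, Pi.neg_apply, one_mul, one_mul, neg_one_mul, neg_one_mul,
      ← sub_eq_add_neg a]

theorem evolutionRelation_eq (h : IsConjugateFrame τ n) (hη : 0 < η) (hs : s₀ < s₁) :
    evolutionRelation η hη τ n s₀ s₁ = range fun p : PrePhase η =>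
      (toPhase η hη τ n p, toPhase η hη τ n (waveFlow hη (s₁ - s₀) p)) := by
  ext z
  constructor
  · rintro ⟨φ, hφ, hw, p₀, p₁, h₀, h₁, rfl⟩
    exact ⟨p₀, by rw [h.eq_waveFlow hη hs hφ.smooth hw h₀ h₁]⟩
  · rintro ⟨p, rfl⟩
    have hmovers := isWavePair_movers (waveFlow hη (-s₀) p)
    have h₀ := h.isBoundaryValue_waveFlow hη hs (waveFlow hη (-s₀) p) (left_mem_Icc.2 hs.le)
    have h₁ := h.isBoundaryValue_waveFlow hη hs (waveFlow hη (-s₀) p) (right_mem_Icc.2 hs.le)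
    rw [← waveFlow_add, add_neg_cancel, waveFlow_zero] at h₀
    rw [← waveFlow_add, ← sub_eq_add_neg] at h₁
    refine ⟨_, hmovers.isField_characteristicField hη.le h.area_ne_zero hs 1 (-1),
      hmovers.solvesWaveEquation_characteristicField h.area_ne_zero hs ?_ ?_, _, _, h₀, h₁, rfl⟩ <;>
      rw [h.mink_sub_smul_self] <;> ring

theorem isLagrangian_evolutionRelation (h : IsConjugateFrame τ n) (hη : 0 < η) (hs : s₀ < s₁) :
    IsLagrangian (stripForm η hη τ n) (evolutionRelation η hη τ n s₀ s₁) := by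
  rw [h.evolutionRelation_eq hη hs]
  refine isLagrangian_graph_of_symplectic hη τ n (fun q => ⟨waveFlow hη (-(s₁ - s₀)) q, ?_⟩)
    (h.preForm_waveFlow hη _)
  rw [← waveFlow_add, add_neg_cancel, waveFlow_zero]

theorem mem_evolutionRelation_iff (h : IsConjugateFrame τ n) (hη : 0 < η) (hs : s₀ < s₁)
    {p₀ p₁ : PrePhase η} :
    (toPhase η hη τ n p₀, toPhase η hη τ n p₁) ∈ evolutionRelation η hη τ n s₀ s₁ ↔
      p₁ = waveFlow hη (s₁ - s₀) p₀ := by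
  have hinj (p q : PrePhase η) : toPhase η hη τ n p = toPhase η hη τ n q ↔ p = q := by
    rw [toPhase_eq_iff, h.ker_preForm hη, Submodule.mem_bot, sub_eq_zero]
  simp only [h.evolutionRelation_eq hη hs, mem_range, Prod.mk.injEq, hinj, exists_eq_left]
  exact eq_comm

end IsConjugateFrame

namespace IsLightlikeFrame

variable {η : ℝ} {τ n : ℝ × ℝ} {s₀ s₁ : ℝ}

theorem isNullPair (h : IsLightlikeFrame τ n) : IsNullPair n τ := by
  obtain ⟨htangent, hnormal, hindep⟩ := h
  simp only [mink, area] at htangent hnormal hindep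
  constructor
  · refine (mul_eq_zero.1 ?_).resolve_left hindep
    linear_combination n.1 * n.2 * htangent - τ.1 * τ.2 * hnormal
  · refine (mul_eq_zero.1 ?_).resolve_left hindep
    linear_combination n.2 * n.2 * htangent - τ.2 * τ.2 * hnormal

theorem toPhase_eq_iff (h : IsLightlikeFrame τ n) (hη : 0 < η) {p q : PrePhase η} :
    toPhase η hη τ n p = toPhase η hη τ n q ↔ p.1 = q.1 := by
  rw [MinkowskiStrip.toPhase_eq_iff, h.mem_ker_preForm_iff, Prod.fst_sub, sub_eq_zero]

theorem fst_eq_of_isBoundaryValue (h : IsLightlikeFrame τ n) (hη : 0 < η) (hs : s₀ < s₁)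
    {φ : ℝ × ℝ → ℝ} (hφ : ContDiffOn ℝ ∞ φ (strip τ n s₀ s₁))
    (hw : SolvesWaveEquation (strip τ n s₀ s₁) φ) {p₀ p₁ : PrePhase η}
    (h₀ : IsBoundaryValue (strip τ n s₀ s₁) τ n s₀ φ p₀)
    (h₁ : IsBoundaryValue (strip τ n s₀ s₁) τ n s₁ φ p₁) : p₀.1 = p₁.1 := by
  have hdiff := hφ.differentiableOn (by simp)
  have hnull : IsNullPair (n - (0 : ℝ) • τ) τ := by simpa using h.isNullPair
  refine Subtype.ext (eq_of_deriv_eq hη p₀.1.2 p₁.1.2 (funext fun a => ?_))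
  rw [h₀.deriv_fst (left_mem_Icc.2 hs.le) hdiff, h₁.deriv_fst (right_mem_Icc.2 hs.le) hdiff,
    fderivWithin_strip_eq_of_isNullPair h.independent hs hφ hw hnull, zero_mul, add_zero]

theorem evolutionRelation_eq (h : IsLightlikeFrame τ n) (hη : 0 < η) (hs : s₀ < s₁) :
    evolutionRelation η hη τ n s₀ s₁ = {z | z.1 = z.2} := by
  refine Subset.antisymm ?_ ?_
  · rintro _ ⟨φ, hφ, hw, p₀, p₁, h₀, h₁, rfl⟩
    exact (h.toPhase_eq_iff hη).2 (h.fst_eq_of_isBoundaryValue hη hs hφ.smooth hw h₀ h₁)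
  · rintro ⟨x, y⟩ (rfl : x = y)
    obtain ⟨p, rfl⟩ := Submodule.mkQ_surjective _ x
    have hp : IsWavePair η (p.1 : ℝ → ℝ) 0 := .of_mem p.1.2 (decaySpace η).zero_mem
    have hnull : mink (n - (0 : ℝ) • τ) (n - (0 : ℝ) • τ) = 0 := by simpa using h.normal
    have hbdry (s : ℝ) (hmem : s ∈ Icc s₀ s₁) :
        IsBoundaryValue (η := η) (strip τ n s₀ s₁) τ n s
          (characteristicField τ n 0 0 (p.1 : ℝ → ℝ) 0) (p.1, 0) :=
      isBoundaryValue_characteristicField h.independent hs hmem (differentiable_of_mem p.1)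
        (differentiable_const 0) (fun a => by simp) (fun a => by simp)
    have hclass : toPhase η hη τ n p = toPhase η hη τ n (p.1, 0) := (h.toPhase_eq_iff hη).2 rfl
    exact ⟨_, hp.isField_characteristicField hη.le h.independent hs 0 0,
      hp.solvesWaveEquation_characteristicField h.independent hs hnull hnull, (p.1, 0), (p.1, 0),
      hbdry s₀ (left_mem_Icc.2 hs.le), hbdry s₁ (right_mem_Icc.2 hs.le),
      Prod.ext hclass hclass⟩

end IsLightlikeFrame

end MinkowskiStrip

end

open MinkowskiStrip in
theorem mainTheorem6_general (η : ℝ) (hη : 0 < η) (τ n : ℝ × ℝ) (s₀ s₁ : ℝ) (hs : s₀ < s₁) :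
    (IsConjugateFrame τ n →
      LinearMap.ker (preForm η hη τ n) = ⊥ ∧
      IsLagrangian (stripForm η hη τ n) (evolutionRelation η hη τ n s₀ s₁) ∧
      ∃ U : ℝ → PrePhase η → PrePhase η,
        IsHamiltonianFlow (preForm η hη τ n) hamiltonian U ∧
        ∀ p₀ p₁ : PrePhase η,
          ((toPhase η hη τ n p₀, toPhase η hη τ n p₁) ∈ evolutionRelation η hη τ n s₀ s₁ ↔
            p₁ = U (s₁ - s₀) p₀)) ∧
    (IsLightlikeFrame τ n →
      (∀ p : PrePhase η, p ∈ LinearMap.ker (preForm η hη τ n) ↔ p.1 = 0) ∧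
      IsLagrangian (stripForm η hη τ n) (evolutionRelation η hη τ n s₀ s₁) ∧
      evolutionRelation η hη τ n s₀ s₁ = {z | z.1 = z.2}) := by
  refine ⟨fun h => ?_, fun h => ?_⟩
  · exact ⟨h.ker_preForm hη, h.isLagrangian_evolutionRelation hη hs, waveFlow hη,
      h.isHamiltonianFlow_waveFlow hη, fun _ _ => h.mem_evolutionRelation_iff hη hs⟩
  · have hdiag := h.evolutionRelation_eq hη hs
    exact ⟨fun _ => h.mem_ker_preForm_iff hη, hdiag ▸ isLagrangian_diagonal hη τ n, hdiag⟩

theorem mainTheorem6 (η : ℝ) (hη : 0 < η) (τ n : ℝ × ℝ) (s₀ s₁ : ℝ) (hs : s₀ < s₁) :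
    ((MinkowskiStrip.IsSpacelikeFrame τ n ∨ MinkowskiStrip.IsTimelikeFrame τ n) →
      LinearMap.ker (MinkowskiStrip.preForm η hη τ n) = ⊥ ∧
      MinkowskiStrip.IsLagrangian (MinkowskiStrip.stripForm η hη τ n)
        (MinkowskiStrip.evolutionRelation η hη τ n s₀ s₁) ∧
      ∃ U : ℝ → MinkowskiStrip.PrePhase η → MinkowskiStrip.PrePhase η,
        MinkowskiStrip.IsHamiltonianFlow (MinkowskiStrip.preForm η hη τ n)
          MinkowskiStrip.hamiltonian U ∧
        ∀ p₀ p₁ : MinkowskiStrip.PrePhase η,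
          ((MinkowskiStrip.toPhase η hη τ n p₀, MinkowskiStrip.toPhase η hη τ n p₁) ∈
            MinkowskiStrip.evolutionRelation η hη τ n s₀ s₁ ↔ p₁ = U (s₁ - s₀) p₀)) ∧
    (MinkowskiStrip.IsLightlikeFrame τ n →
      (∀ p : MinkowskiStrip.PrePhase η,
        p ∈ LinearMap.ker (MinkowskiStrip.preForm η hη τ n) ↔ p.1 = 0) ∧
      MinkowskiStrip.IsLagrangian (MinkowskiStrip.stripForm η hη τ n)
        (MinkowskiStrip.evolutionRelation η hη τ n s₀ s₁) ∧
      MinkowskiStrip.evolutionRelation η hη τ n s₀ s₁ = {z | z.1 = z.2}) :=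
  (mainTheorem6_general η hη τ n s₀ s₁ hs).imp_left fun hconj hframe =>
    hconj (hframe.elim (·.isConjugateFrame) (·.isConjugateFrame))
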